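/- Let $\mathbb F$ be a field of characteristic $p>3$ and let $0\le s<n$ be integers. Definitions. Let $\mathbb F[x;n]$ be the algebra of divided powers, with basis $x^{(i)}$, $0\le i<p^n$, and multiplication $x^{(i)}x^{(j)}=\binom{i+j}{i}x^{(i+j)}$ (where $x^{(k)}=0$ for $k\ge p^n$). Let $\partial$ be its derivation with $\partial x^{(i)}=x^{(i-1)}$ for $i>0$ and $\partial x^{(0)}=0$. The Zassenhaus algebra $W(1;n)$ is the Lie algebra of all derivations $f\partial$ with $f\in\mathbb F[x;n]$. Its standard $\mathbb Z$-grading has as component of degree $i$ the span of $x^{(i+1)}\partial$ if $-1\le i<p^n-1$, and $0$ otherwise. The Artin–Hasse series is $E_p(X)=\exp\bigl(\sum_{i\ge 0}X^{p^i}/p^i\bigr)$; its coefficients are rational numbers with denominators prime to $p$, so that, reduced modulo $p$, it can be evaluated on nilpotent $\mathbb F$-linear maps. All gradings considered are gradings $A=\bigoplus_{g\in G}A_g$ over abelian groups $G$, with $[A_g,A_h]\subseteq A_{g+h}$. The support is $\{g: A_g\ne 0\}$. A grading $\Gamma$ is a refinement of $\Gamma'$ (and $\Gamma'$ a coarsening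 of $\Gamma$) if each component of $\Gamma$ is contained in a component of $\Gamma'$; it is a proper refinement if this containment is strict for at least one nonzero component of $\Gamma$. A grading is fine if it has no proper refinement. The group $G$ is the universal group of a $G$-grading $A=\bigoplus_{g\in G} A_g$ if for every coarsening $A=\bigoplus_{h\in H}A'_h$, over any abelian group $H$, there is a unique group homomorphism $f:G\to H$ with $A_g\subseteq A'_{f(g)}$ for all $g\in G$. Two gradings of $A$ are equivalent if there are a Lie algebra automorphism $\varphi$ of $A$ and a bijection $\alpha$ between their supports such that $\varphi$ maps the component of each degree $g$ in the support of the first onto the component of degree $\alpha(g)$ of the second. Statement. The standard decomposition is a $\mathbb Z$-grading of $W(1;n)$, and the linear map $D=(\operatorname{ad}\partial)^{p^s}$ on $W(1;n)$ is a derivation, is graded of degree $-p^s$ with respect to it, and satisfies $D^{p^{n-s}}=0$. Let $W(1;n)=\bigoplus_{i\in\mathbb Z/p^{s+1}\mathbb Z}B_i$ be the decomposition obtained from the standard $\mathbb Z$-grading by viewing the degrees modulo $p^{s+1}$. Then $$W(1;n)=\bigoplus_{i\in\mathbb Z/p^{s+1}\mathbb Z}E_p(D)B_i$$ is a $(\mathbb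 Z/p^{s+1}\mathbb Z)$-grading of $W(1;n)$, its support generates $\mathbb Z/p^{s+1}\mathbb Z$, and $\mathbb Z/p^{s+1}\mathbb Z$ is its universal group. If $n=s+1$, this grading is fine, and it is not equivalent to the standard $\mathbb Z$-grading. -/

import Mathlib

universe u v w x

noncomputable section

/-! ### Group gradings of Lie algebras -/

section Gradings

variable {F : Type u} {L : Type v} [Field F] [LieRing L] [LieAlgebra F L]

open Classical in
/-- `Γ` is a grading of the Lie algebra `L` over the abelian group `G`. -/
structure IsLieGrading {G : Type*} [AddCommGroup G] (Γ : G → Submodule F L) : Prop where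
  isInternal : DirectSum.IsInternal Γ
  lie_mem : ∀ g₁ g₂ : G, ∀ x ∈ Γ g₁, ∀ y ∈ Γ g₂, ⁅x, y⁆ ∈ Γ (g₁ + g₂)

/-- The support of a family of subspaces. -/
def gradingSupport {G : Type*} (Γ : G → Submodule F L) : Set G := {g | Γ g ≠ ⊥}

/-- `Γ` is a refinement of `Γ'` (and `Γ'` is a coarsening of `Γ`). -/
def IsRefinement {G : Type*} {G' : Type*} (Γ : G → Submodule F L)
    (Γ' : G' → Submodule F L) : Prop :=
  ∀ g, ∃ g', Γ g ≤ Γ' g'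

/-- `Γ` is a proper refinement of `Γ'`: some (nonzero) component of `Γ` is strictly contained in
a component of `Γ'`. -/
def IsProperRefinement {G : Type*} {G' : Type*} (Γ : G → Submodule F L)
    (Γ' : G' → Submodule F L) : Prop :=
  IsRefinement Γ Γ' ∧ ∃ g ∈ gradingSupport Γ, ∃ g', Γ g < Γ' g'

/-- `Γ` has no proper refinement among the group gradings of `L`. -/
def IsFineGrading {G : Type x} (Γ : G → Submodule F L) : Prop :=
  ∀ (H : Type w) [AddCommGroup H] (Γ' : H → Submodule F L),
    IsLieGrading Γ' → ¬ IsProperRefinement Γ' Γ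

/-- `G` is the universal group of the `G`-grading `Γ`. -/
def IsUniversalGroup {G : Type x} [AddCommGroup G] (Γ : G → Submodule F L) : Prop :=
  ∀ (H : Type w) [AddCommGroup H] (Γ' : H → Submodule F L),
    IsLieGrading Γ' → IsRefinement Γ Γ' → ∃! f : G →+ H, ∀ g, Γ g ≤ Γ' (f g)

/-- Equivalence of gradings: an automorphism of `L` and a bijection between the supports that
carry the components of one grading to those of the other. -/
def AreEquivalentGradings {G : Type*} {G' : Type*} (Γ : G → Submodule F L)
    (Γ' : G' → Submodule F L) : Prop :=
  ∃ (φ : L ≃ₗ⁅F⁆ L) (α : gradingSupport Γ ≃ gradingSupport Γ'),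
    ∀ s : gradingSupport Γ, (Γ s).map (φ : L →ₗ[F] L) = Γ' (α s)

/-- A `ℤ`-grading with the degrees viewed modulo `m`. -/
def gradingMod (m : ℕ) (Γ : ℤ → Submodule F L) (i : ZMod m) : Submodule F L :=
  ⨆ j ∈ {j : ℤ | (j : ZMod m) = i}, Γ j

end Gradings

/-! ### The Artin–Hasse exponential -/

open PowerSeries in
/-- The series `∑ X ^ (p ^ i) / p ^ i`. -/
def artinHasseLog (p : ℕ) : PowerSeries ℚ :=
  open Classical in PowerSeries.mk fun k => if ∃ i : ℕ, k = p ^ i then (k : ℚ)⁻¹ else 0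

/-- The Artin–Hasse exponential series `exp (∑ X ^ (p ^ i) / p ^ i)`. -/
def artinHasse (p : ℕ) : PowerSeries ℚ :=
  (PowerSeries.exp ℚ).subst (artinHasseLog p)

/-- The Artin–Hasse exponential `E_p(T)` of a nilpotent endomorphism `T` of a vector space in
characteristic `p`. The coefficients of the series have denominators prime to `p`, so the cast
of a coefficient `a / b` to `F` is its reduction `a * b⁻¹` modulo `p`. -/
def artinHasseEnd {F V : Type*} [Field F] [AddCommGroup V] [Module F V] (p : ℕ)
    (T : Module.End F V) : Module.End F V :=
  ∑ k ∈ Finset.range (nilpotencyClass T), ((PowerSeries.coeff k (artinHasse p) : ℚ) : F) • T ^ k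

/-! ### Divided power algebras and Zassenhaus algebras -/

/-- The vector space with basis `x^(i)`, `0 ≤ i < p ^ n`, that underlies the algebra `𝔽[x; n]` of
divided powers of height `n` in one indeterminate. -/
def DivPow (F : Type*) (p n : ℕ) : Type _ := Fin (p ^ n) → F

namespace DivPow

variable (F : Type*) [Field F] (p n : ℕ)

instance : AddCommGroup (DivPow F p n) := inferInstanceAs (AddCommGroup (Fin (p ^ n) → F))

instance : Module F (DivPow F p n) := inferInstanceAs (Module F (Fin (p ^ n) → F))

/-- The basis of the monomials `x^(i)`. -/
def basis : Module.Basis (Fin (p ^ n)) F (DivPow F p n) := Pi.basisFun F (Fin (p ^ n))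

/-- The divided power `x^(k)`, which is zero for `k ≥ p ^ n`. -/
def X (k : ℕ) : DivPow F p n := if h : k < p ^ n then basis F p n ⟨k, h⟩ else 0

lemma basis_eq (i : Fin (p ^ n)) : basis F p n i = X F p n i := by
  simp [X]

lemma X_of_le {k : ℕ} (h : p ^ n ≤ k) : X F p n k = 0 := by
  simp [X, Nat.not_lt.mpr h]

/-- The bilinear multiplication `x^(i) * x^(j) = (i + j choose i) x^(i + j)`. -/
def mulMap : DivPow F p n →ₗ[F] DivPow F p n →ₗ[F] DivPow F p n :=
  (basis F p n).constr F fun i => (basis F p n).constr F fun j =>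
    (((i : ℕ) + j).choose i : F) • X F p n (i + j)

instance : Mul (DivPow F p n) := ⟨fun a b => mulMap F p n a b⟩

instance : One (DivPow F p n) := ⟨X F p n 0⟩

lemma mul_def (a b : DivPow F p n) : a * b = mulMap F p n a b := rfl

lemma one_def : (1 : DivPow F p n) = X F p n 0 := rfl

lemma mulMap_X (i j : ℕ) :
    mulMap F p n (X F p n i) (X F p n j) = ((i + j).choose i : F) • X F p n (i + j) := by
  by_cases hi : i < p ^ n
  · by_cases hj : j < p ^ n
    · have e1 : X F p n i = basis F p n ⟨i, hi⟩ := (basis_eq F p n ⟨i, hi⟩).symm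
      have e2 : X F p n j = basis F p n ⟨j, hj⟩ := (basis_eq F p n ⟨j, hj⟩).symm
      rw [e1, e2, mulMap, Module.Basis.constr_basis, Module.Basis.constr_basis]
    · rw [X_of_le F p n (not_lt.mp hj), X_of_le F p n (k := i + j) (by omega)]
      simp
  · rw [X_of_le F p n (not_lt.mp hi), X_of_le F p n (k := i + j) (by omega)]
    simp

lemma X_mul_X (i j : ℕ) :
    X F p n i * X F p n j = ((i + j).choose i : F) • X F p n (i + j) := mulMap_X F p n i j

lemma mul_comm' (a b : DivPow F p n) : a * b = b * a := by
  have h : mulMap F p n = (mulMap F p n).flip := by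
    refine (basis F p n).ext fun i => (basis F p n).ext fun j => ?_
    rw [LinearMap.flip_apply]
    simp only [basis_eq, mulMap_X]
    rw [Nat.choose_symm_add, add_comm (j : ℕ)]
  exact congrArg (fun f => f a b) h

lemma one_mul' (a : DivPow F p n) : 1 * a = a := by
  have h : mulMap F p n (X F p n 0) = LinearMap.id := by
    refine (basis F p n).ext fun i => ?_
    simp [basis_eq, mulMap_X]
  exact congrArg (fun f => f a) h

lemma mul_assoc_X (i j k : ℕ) :
    X F p n i * X F p n j * X F p n k = X F p n i * (X F p n j * X F p n k) := by
  have h : (i + j).choose i * (i + j + k).choose (i + j) =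
      (j + k).choose j * (i + (j + k)).choose i := by
    have h1 := Nat.add_choose_mul_factorial_mul_factorial i j
    have h2 := Nat.add_choose_mul_factorial_mul_factorial (i + j) k
    have h3 := Nat.add_choose_mul_factorial_mul_factorial j k
    have h4 := Nat.add_choose_mul_factorial_mul_factorial i (j + k)
    rw [← Nat.choose_symm_add] at h1 h2 h3 h4
    have e1 : (i + j).choose i * (i + j + k).choose (i + j) *
        (i.factorial * j.factorial * k.factorial) = (i + j + k).factorial := by
      rw [← h2, ← h1]; ring
    have e2 : (j + k).choose j * (i + (j + k)).choose i *
        (i.factorial * j.factorial * k.factorial) = (i + (j + k)).factorial := by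
      rw [← h4, ← h3]; ring
    have hpos : 0 < i.factorial * j.factorial * k.factorial := by positivity
    exact Nat.eq_of_mul_eq_mul_right hpos (by rw [e1, e2, add_assoc])
  have h' := congrArg (Nat.cast : ℕ → F) h
  push_cast at h'
  simp only [mul_def, mulMap_X, map_smul, LinearMap.smul_apply, smul_smul]
  rw [h', add_assoc]

lemma mul_assoc' (a b c : DivPow F p n) : a * b * c = a * (b * c) := by
  have h1 : ∀ (i j : Fin (p ^ n)) (c : DivPow F p n),
      X F p n i * X F p n j * c = X F p n i * (X F p n j * c) := by
    intro i j c
    have h : mulMap F p n (X F p n i * X F p n j) =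
        mulMap F p n (X F p n i) ∘ₗ mulMap F p n (X F p n j) := by
      refine (basis F p n).ext fun k => ?_
      rw [basis_eq]
      exact mul_assoc_X F p n i j k
    exact congrArg (fun f => f c) h
  have h2 : ∀ (i : Fin (p ^ n)) (b c : DivPow F p n),
      X F p n i * b * c = X F p n i * (b * c) := by
    intro i b c
    have h : (mulMap F p n).flip c ∘ₗ mulMap F p n (X F p n i) =
        mulMap F p n (X F p n i) ∘ₗ (mulMap F p n).flip c := by
      refine (basis F p n).ext fun j => ?_
      rw [basis_eq]
      exact h1 i j c
    exact congrArg (fun f => f b) h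
  have h : (mulMap F p n).flip c ∘ₗ (mulMap F p n).flip b = (mulMap F p n).flip (b * c) := by
    refine (basis F p n).ext fun i => ?_
    rw [basis_eq]
    exact h2 i b c
  exact congrArg (fun f => f a) h

/-- `𝔽[x; n]` as a commutative ring. -/
instance : CommRing (DivPow F p n) :=
  { (inferInstance : AddCommGroup (DivPow F p n)),
    (inferInstance : Mul (DivPow F p n)),
    (inferInstance : One (DivPow F p n)) with
    left_distrib := fun a b c => map_add (mulMap F p n a) b c
    right_distrib := fun a b c => LinearMap.map_add₂ (mulMap F p n) a b c
    zero_mul := fun a => LinearMap.map_zero₂ (mulMap F p n) a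
    mul_zero := fun a => map_zero (mulMap F p n a)
    mul_assoc := mul_assoc' F p n
    one_mul := one_mul' F p n
    mul_one := fun a => (mul_comm' F p n a 1).trans (one_mul' F p n a)
    mul_comm := mul_comm' F p n }

instance : Algebra F (DivPow F p n) :=
  Algebra.ofModule (fun r a b => LinearMap.map_smul₂ (mulMap F p n) r a b)
    (fun r a b => map_smul (mulMap F p n a) r b)

/-- The linear map `x^(i) ↦ x^(i - 1)`, `x^(0) ↦ 0`. -/
def derivMap : DivPow F p n →ₗ[F] DivPow F p n :=
  (basis F p n).constr F fun i => if (i : ℕ) = 0 then 0 else X F p n (i - 1)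

variable {p n} in
lemma derivMap_X {k : ℕ} (hk : k < p ^ n) :
    derivMap F p n (X F p n k) = if k = 0 then 0 else X F p n (k - 1) := by
  rw [← basis_eq F p n ⟨k, hk⟩, derivMap, Module.Basis.constr_basis]

variable [Fact p.Prime] [CharP F p]

lemma derivMap_mul (a b : DivPow F p n) :
    derivMap F p n (a * b) = a • derivMap F p n b + b • derivMap F p n a := by
  have h1 : ∀ (i j : Fin (p ^ n)), derivMap F p n (X F p n i * X F p n j) =
      X F p n i * derivMap F p n (X F p n j) + X F p n j * derivMap F p n (X F p n i) := by
    intro ⟨i, hi⟩ ⟨j, hj⟩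
    simp only
    rw [X_mul_X, map_smul, derivMap_X F hi, derivMap_X F hj]
    rcases Nat.eq_zero_or_pos i with rfl | hi0
    · simp only [zero_add, Nat.choose_zero_right, Nat.cast_one, one_smul, if_true, mul_zero,
        add_zero]
      rw [derivMap_X F hj]
      split_ifs
      · simp
      · rw [X_mul_X]; simp
    rcases Nat.eq_zero_or_pos j with rfl | hj0
    · rw [add_zero, derivMap_X F hi]
      simp [hi0.ne', X_mul_X]
    obtain ⟨i, rfl⟩ : ∃ i', i = i' + 1 := ⟨i - 1, by omega⟩
    obtain ⟨j, rfl⟩ : ∃ j', j = j' + 1 := ⟨j - 1, by omega⟩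
    have e : (i + 1 + (j + 1)).choose (i + 1) = (i + 1 + j).choose (i + 1) +
        (j + 1 + i).choose (j + 1) := by
      rw [show i + 1 + (j + 1) = (i + 1 + j) + 1 by ring, Nat.choose_succ_succ, add_comm,
        show j + 1 + i = i + (j + 1) by ring, ← Nat.choose_symm_add (a := i) (b := j + 1),
        show i + (j + 1) = i + 1 + j by ring]
    have lhs : ((i + 1 + (j + 1)).choose (i + 1) : F) •
          derivMap F p n (X F p n (i + 1 + (j + 1))) =
        ((i + 1 + (j + 1)).choose (i + 1) : F) • X F p n (i + j + 1) := by
      rcases lt_trichotomy (i + 1 + (j + 1)) (p ^ n) with h | h | h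
      · rw [derivMap_X F h, if_neg (by omega), show i + 1 + (j + 1) - 1 = i + j + 1 by omega]
      · have hc : ((i + 1 + (j + 1)).choose (i + 1) : F) = 0 := by
          rw [CharP.cast_eq_zero_iff F p, h]
          exact (Fact.out : p.Prime).dvd_choose_pow (by omega) (by omega)
        rw [hc, zero_smul, zero_smul]
      · rw [X_of_le F p n h.le, X_of_le F p n (k := i + j + 1) (by omega), map_zero]
    rw [lhs, if_neg (by omega), if_neg (by omega), Nat.add_sub_cancel, Nat.add_sub_cancel,
      X_mul_X, X_mul_X, e, show j + 1 + i = i + j + 1 by ring,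
      show i + 1 + j = i + j + 1 by ring, ← add_smul, Nat.cast_add]
  have h2 : ∀ (i : Fin (p ^ n)) (b : DivPow F p n), derivMap F p n (X F p n i * b) =
      X F p n i * derivMap F p n b + b * derivMap F p n (X F p n i) := by
    intro i b
    have h : derivMap F p n ∘ₗ mulMap F p n (X F p n i) =
        mulMap F p n (X F p n i) ∘ₗ derivMap F p n +
          (mulMap F p n).flip (derivMap F p n (X F p n i)) := by
      refine (basis F p n).ext fun j => ?_
      rw [basis_eq]
      exact h1 i j
    exact congrArg (fun f => f b) h
  have h : derivMap F p n ∘ₗ (mulMap F p n).flip b =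
      (mulMap F p n).flip (derivMap F p n b) + mulMap F p n b ∘ₗ derivMap F p n := by
    refine (basis F p n).ext fun i => ?_
    rw [basis_eq]
    exact h2 i b
  exact congrArg (fun f => f a) h

/-- The derivation `∂` of `𝔽[x; n]`, with `∂ x^(i) = x^(i - 1)` and `∂ x^(0) = 0`. -/
def partialD : Derivation F (DivPow F p n) (DivPow F p n) :=
  Derivation.mk' (derivMap F p n) (derivMap_mul F p n)

lemma lie_smul_partialD (f g : DivPow F p n) :
    ⁅f • partialD F p n, g • partialD F p n⁆ =
      (f * partialD F p n g - g * partialD F p n f) • partialD F p n := by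
  ext a
  simp only [Derivation.commutator_apply, Derivation.smul_apply, smul_eq_mul,
    Derivation.leibniz]
  ring

end DivPow

section Zassenhaus

variable (F : Type*) [Field F] (p n : ℕ) [Fact p.Prime] [CharP F p]

/-- The Zassenhaus algebra `W(1; n)`: the Lie algebra of the special derivations `f ∂` of the
divided power algebra `𝔽[x; n]`. -/
def Zassenhaus : LieSubalgebra F (Derivation F (DivPow F p n) (DivPow F p n)) where
  carrier := {E | ∃ f : DivPow F p n, E = f • DivPow.partialD F p n}
  add_mem' := by
    rintro _ _ ⟨f, rfl⟩ ⟨g, rfl⟩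
    exact ⟨f + g, (add_smul f g _).symm⟩
  zero_mem' := ⟨0, (zero_smul _ _).symm⟩
  smul_mem' := by
    rintro c _ ⟨f, rfl⟩
    exact ⟨c • f, (smul_assoc c f _).symm⟩
  lie_mem' := by
    rintro _ _ ⟨f, rfl⟩ ⟨g, rfl⟩
    exact ⟨_, DivPow.lie_smul_partialD F p n f g⟩

namespace Zassenhaus

/-- The element `x^(k) ∂` of `W(1; n)`. -/
def elt (k : ℕ) : Zassenhaus F p n := ⟨DivPow.X F p n k • DivPow.partialD F p n, _, rfl⟩

/-- The element `∂` of `W(1; n)`. -/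
def del : Zassenhaus F p n := ⟨DivPow.partialD F p n, 1, (one_smul _ _).symm⟩

/-- The standard `ℤ`-grading of `W(1; n)`: for `-1 ≤ i < p ^ n - 1` the component of degree `i` is
spanned by `x^(i + 1) ∂`, all other components are zero. -/
def stdGrading (i : ℤ) : Submodule F (Zassenhaus F p n) :=
  Submodule.span F {w | ∃ k : ℕ, k < p ^ n ∧ (k : ℤ) = i + 1 ∧ w = elt F p n k}

/-- The linear map `D = (ad ∂) ^ (p ^ s)` on `W(1; n)`. -/
def D (s : ℕ) : Module.End F (Zassenhaus F p n) :=
  LieAlgebra.ad F (Zassenhaus F p n) (del F p n) ^ p ^ s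

/-- The family of the images under `E_p(D)` of the components of the standard grading with its
degrees viewed modulo `p ^ (s + 1)`. -/
def switchedGrading (s : ℕ) (i : ZMod (p ^ (s + 1))) : Submodule F (Zassenhaus F p n) :=
  (gradingMod (p ^ (s + 1)) (stdGrading F p n) i).map (artinHasseEnd p (D F p n s))

end Zassenhaus

end Zassenhaus

end

/-!
The standard grading and its coarsening modulo `p ^ (s + 1)` are read off from the basis
`x^(k) ∂`. Images of a grading under an exponential of a derivation usually need the exponential
to be multiplicative. For the Artin–Hasse exponential in characteristic `p` a weaker property
holds: `E_p` satisfies `X E_p' = L E_p` with `L = ∑ X ^ (p ^ i)`, and `L` is additive modulo `p`,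
so the Euler derivation kills `E_p(X) E_p(Y) / E_p(X + Y)`; this quotient therefore has only
components of degrees divisible by `p` (`coeff_artinHasseCocycle_eq_zero`). Evaluated at
`X = D ⊗ 1` and `Y = 1 ⊗ D`, it says that `E_p(D)⁻¹ [E_p(D) a, E_p(D) b]` is a sum of brackets
`D ^ l [D ^ i a, D ^ j b]` with `p ∣ i + j + l`. As `D` has degree `-p ^ s` and
`p * p ^ s = 0` modulo `p ^ (s + 1)`, all of these lie in the same component
(`IsLieGrading.map_artinHasseEnd`). That `E_p` can be reduced modulo `p` at all follows by
Dwork's argument from `E_p(X) ^ p = E_p(X ^ p) exp(p X)` (`coeff_artinHasse_mem`).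

For the universal group, let `α` be the map of degrees from the switched grading to a coarsening.
`E_p(D)` commutes with `ad ∂`, so bracketing with `∂`, of degree `-1`, shows that `α(k) = k c`
with `c = -α(-1)` for `-1 ≤ k < p ^ (s + 1) - 1` (`Zassenhaus.degree_eq_zsmul`). The relation
`p ^ (s + 1) c = 0` (`Zassenhaus.pow_smul_degree_del`) comes from going once around the circle
when `s + 1 < n`, and from one explicit nonzero bracket when `n = s + 1`
(`Zassenhaus.lie_switchedElt_ne_zero`); the case `s = 0` of the latter needs `p > 3`.

For `n = s + 1` the components are one-dimensional, hence the grading is fine. An equivalence with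
the standard grading would give a coarsening over `ℤ`, thus a homomorphism from the finite
universal group to `ℤ`; it is zero, and the standard grading would have a single component.
-/

/-! ### Rational numbers with denominators prime to `p` -/

section PIntegral

variable (p : ℕ) [Fact p.Prime]

/-- The ring of the rational numbers whose denominators are prime to `p`. -/
def pIntegralRat : Subring ℚ where
  carrier := {q | ¬ p ∣ q.den}
  mul_mem' := by
    intro a b ha hb h
    exact ((Fact.out : p.Prime).dvd_mul.mp (h.trans (Rat.mul_den_dvd a b))).elim ha hb
  one_mem' := by simpa using (Fact.out : p.Prime).ne_one
  add_mem' := by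
    intro a b ha hb h
    exact ((Fact.out : p.Prime).dvd_mul.mp (h.trans (Rat.add_den_dvd a b))).elim ha hb
  zero_mem' := by simpa using (Fact.out : p.Prime).ne_one
  neg_mem' := by
    intro a ha
    simpa using ha

variable {p}

lemma mem_pIntegralRat_of_mul_eq_intCast {q : ℚ} {d m : ℤ} (hd : ¬ (p : ℤ) ∣ d)
    (h : q * d = m) : q ∈ pIntegralRat p := by
  have hd0 : (d : ℚ) ≠ 0 := by
    rintro h0
    exact hd (by simp [Int.cast_eq_zero.mp h0])
  have hq : q = Rat.divInt m d := by
    rw [Rat.divInt_eq_div, eq_div_iff hd0, h]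
  intro hdvd
  refine hd ((Int.natCast_dvd_natCast.mpr hdvd).trans ?_)
  rw [hq]
  exact Rat.den_dvd m d

/-- Reduction modulo `p` of the `p`-integral rational numbers, into a field of
characteristic `p`. -/
def pIntegralRatCast (F : Type*) [Field F] [CharP F p] : pIntegralRat p →+* F where
  toFun q := ((q : ℚ) : F)
  map_one' := by simp
  map_zero' := by simp
  map_mul' a b := Rat.cast_mul_of_ne_zero (by rw [Ne, CharP.cast_eq_zero_iff F p]; exact a.2)
    (by rw [Ne, CharP.cast_eq_zero_iff F p]; exact b.2)
  map_add' a b := Rat.cast_add_of_ne_zero (by rw [Ne, CharP.cast_eq_zero_iff F p]; exact a.2)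
    (by rw [Ne, CharP.cast_eq_zero_iff F p]; exact b.2)

lemma pIntegralRatCast_apply (F : Type*) [Field F] [CharP F p] (q : pIntegralRat p) :
    pIntegralRatCast F q = ((q : ℚ) : F) := rfl

lemma exists_eq_mul_of_pIntegralRatCast_eq_zero {x : pIntegralRat p}
    (h : pIntegralRatCast (ZMod p) x = 0) : ∃ r : pIntegralRat p, x = p * r := by
  have hden : ((x : ℚ).den : ZMod p) ≠ 0 := by
    rw [Ne, CharP.cast_eq_zero_iff (ZMod p) p]
    exact x.2
  have hnum : ((x : ℚ).num : ZMod p) = 0 := by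
    rw [pIntegralRatCast_apply, Rat.cast_def] at h
    exact (div_eq_zero_iff.mp h).resolve_right hden
  obtain ⟨m, hm⟩ := (ZMod.intCast_zmod_eq_zero_iff_dvd _ p).mp hnum
  have hp0 : (p : ℚ) ≠ 0 := Nat.cast_ne_zero.mpr (Fact.out : p.Prime).ne_zero
  have hx : (x : ℚ) * (x : ℚ).den = p * m := by
    rw [Rat.mul_den_eq_num, hm]
    push_cast
    rfl
  refine ⟨⟨(x : ℚ) / p, mem_pIntegralRat_of_mul_eq_intCast (d := (x : ℚ).den) (m := m)
    ?_ ?_⟩, ?_⟩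
  · rw [Int.natCast_dvd_natCast]
    exact x.2
  · push_cast
    field_simp
    linarith
  · ext
    push_cast
    field_simp

/-- The `p`-adic valuation of `j!` is less than `j`, so `p ^ j / j!` is divisible by `p`. -/
lemma pow_div_factorial_div_mem_pIntegralRat {j : ℕ} (hj : j ≠ 0) :
    (p : ℚ) ^ j / j.factorial / p ∈ pIntegralRat p := by
  have hpp : p.Prime := Fact.out
  have hp0 : (p : ℚ) ≠ 0 := Nat.cast_ne_zero.mpr hpp.ne_zero
  obtain ⟨v, u, hu, hju⟩ :=
    Nat.exists_eq_pow_mul_and_not_dvd (Nat.factorial_ne_zero j) p hpp.ne_one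
  have hu0 : (u : ℚ) ≠ 0 := by
    rw [Nat.cast_ne_zero]
    rintro rfl
    exact hu (dvd_zero p)
  have hv : v < j := by
    have h := padicValNat_factorial_lt_of_ne_zero (p := p) hj
    rw [hju, padicValNat.mul (pow_ne_zero _ hpp.ne_zero) (by rintro rfl; exact hu (dvd_zero p)),
      padicValNat.prime_pow, padicValNat.eq_zero_of_not_dvd hu] at h
    exact h
  obtain ⟨w, rfl⟩ : ∃ w, j = v + w + 1 := ⟨j - v - 1, by omega⟩
  refine mem_pIntegralRat_of_mul_eq_intCast (d := u) (m := p ^ w)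
    (by rwa [Int.natCast_dvd_natCast]) ?_
  rw [hju]
  push_cast
  field_simp
  ring

end PIntegral

/-! ### Integrality of the Artin–Hasse exponential -/

section ArtinHasse

open PowerSeries

/-- Uniqueness of the solutions of a linear differential equation for power series. -/
lemma PowerSeries.eq_of_derivative_eq_mul {M f g : ℚ⟦X⟧} (hf : d⁄dX ℚ f = M * f)
    (hg : d⁄dX ℚ g = M * g) (h0 : constantCoeff f = constantCoeff g) : f = g := by
  rw [← sub_eq_zero]
  have hy : d⁄dX ℚ (f - g) = M * (f - g) := by rw [map_sub, hf, hg, mul_sub]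
  have hy0 : coeff 0 (f - g) = 0 := by simp [h0]
  generalize f - g = y at hy hy0
  ext k
  rw [map_zero]
  induction k using Nat.strong_induction_on with
  | _ k ih =>
    rcases k with _ | k
    · exact hy0
    have h := congrArg (coeff k) hy
    rw [coeff_derivative, coeff_mul, Finset.sum_eq_zero] at h
    · exact (mul_eq_zero.mp h).resolve_right (by positivity)
    · rintro ⟨i, j⟩ hij
      rw [Finset.HasAntidiagonal.mem_antidiagonal] at hij
      rw [ih j (by simp only at hij; omega), mul_zero]

/-- The exponential of a power series (meaningful when the constant term is zero). -/
noncomputable def PowerSeries.expOf (f : ℚ⟦X⟧) : ℚ⟦X⟧ := (exp ℚ).subst f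

variable {f g : ℚ⟦X⟧}

lemma PowerSeries.derivative_expOf (hf : constantCoeff f = 0) :
    d⁄dX ℚ (expOf f) = d⁄dX ℚ f * expOf f := by
  rw [expOf, derivative_subst (HasSubst.of_constantCoeff_zero' hf), derivative_exp, mul_comm]

lemma PowerSeries.constantCoeff_expOf (hf : constantCoeff f = 0) :
    constantCoeff (expOf f) = 1 := by
  have hs : HasSubst f := HasSubst.of_constantCoeff_zero' hf
  have h0 : constantCoeff ((exp ℚ - 1).subst f) = 0 :=
    constantCoeff_subst_eq_zero hf (exp ℚ - 1) (by simp)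
  have h1 : (1 : ℚ⟦X⟧).subst f = (1 : ℚ⟦X⟧) := by rw [← coe_substAlgHom hs, map_one]
  have h2 : constantCoeff ((exp ℚ - 1).subst f) =
      constantCoeff ((exp ℚ).subst f) - constantCoeff ((1 : ℚ⟦X⟧).subst f) := by
    rw [← map_sub]
    congr 1
    exact subst_sub hs _ _
  rw [h1, map_one] at h2
  rw [expOf]
  linarith

lemma PowerSeries.expOf_add (hf : constantCoeff f = 0) (hg : constantCoeff g = 0) :
    expOf (f + g) = expOf f * expOf g := by
  have hfg : constantCoeff (f + g) = 0 := by rw [map_add, hf, hg, add_zero]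
  refine eq_of_derivative_eq_mul (derivative_expOf hfg) ?_ ?_
  · rw [Derivation.leibniz, derivative_expOf hf, derivative_expOf hg, map_add, smul_eq_mul,
      smul_eq_mul]
    ring
  · rw [map_mul, constantCoeff_expOf hf, constantCoeff_expOf hg, constantCoeff_expOf hfg, one_mul]

lemma PowerSeries.expOf_nsmul (hf : constantCoeff f = 0) (k : ℕ) :
    expOf (k • f) = expOf f ^ k := by
  induction k with
  | zero =>
    refine eq_of_derivative_eq_mul (M := 0) ?_ ?_ ?_
    · rw [zero_smul, derivative_expOf (map_zero _), map_zero]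
    · simp
    · rw [zero_smul, constantCoeff_expOf (map_zero _), pow_zero, map_one]
  | succ k ih => rw [succ_nsmul, expOf_add (by simp [hf]) hf, ih, pow_succ]

lemma PowerSeries.coeff_expOf_nsmul_X (k j : ℕ) :
    coeff j (expOf (k • X)) = (k : ℚ) ^ j / j.factorial := by
  rw [expOf_nsmul (by simp), expOf, X_subst, exp_pow_eq_rescale_exp, coeff_rescale, coeff_exp]
  simp [div_eq_mul_inv]

lemma PowerSeries.expand_expOf {p : ℕ} (hp : p ≠ 0) (hf : constantCoeff f = 0) :
    expand p hp (expOf f) = expOf (expand p hp f) :=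
  expand_subst p hp (HasSubst.of_constantCoeff_zero' hf) _

variable {p : ℕ}

lemma coeff_artinHasseLog_pow (i : ℕ) : coeff (p ^ i) (artinHasseLog p) = ((p : ℚ) ^ i)⁻¹ := by
  rw [artinHasseLog, coeff_mk, if_pos ⟨i, rfl⟩]
  push_cast
  rfl

lemma coeff_artinHasseLog_of_ne {k : ℕ} (h : ∀ i, k ≠ p ^ i) :
    coeff k (artinHasseLog p) = 0 := by
  rw [artinHasseLog, coeff_mk, if_neg (by simpa using h)]

/-- The series `∑ X ^ (p ^ i)`, which is the logarithmic derivative `X E_p'(X) / E_p(X)`. -/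
noncomputable def primePowSeries (R : Type*) [Semiring R] (p : ℕ) : R⟦X⟧ :=
  open Classical in PowerSeries.mk fun k => if ∃ i : ℕ, k = p ^ i then 1 else 0

lemma map_primePowSeries {R S : Type*} [Semiring R] [Semiring S] (φ : R →+* S) (k : ℕ) :
    coeff k (primePowSeries S p) = φ (coeff k (primePowSeries R p)) := by
  simp only [primePowSeries, coeff_mk]
  split_ifs <;> simp

lemma artinHasse_eq_expOf : artinHasse p = expOf (artinHasseLog p) := rfl

variable [Fact p.Prime]

lemma constantCoeff_artinHasseLog : constantCoeff (artinHasseLog p) = 0 := by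
  rw [← coeff_zero_eq_constantCoeff_apply]
  exact coeff_artinHasseLog_of_ne fun i => (pow_pos (Fact.out : p.Prime).pos i).ne

lemma nsmul_artinHasseLog :
    p • artinHasseLog p =
      expand p (Fact.out : p.Prime).ne_zero (artinHasseLog p) + p • X := by
  have hp : p.Prime := Fact.out
  have hp0 : (p : ℚ) ≠ 0 := Nat.cast_ne_zero.mpr hp.ne_zero
  ext k
  rw [map_nsmul, map_add, map_nsmul, coeff_X, coeff_expand]
  by_cases hk : ∃ i, k = p ^ i
  · obtain ⟨i, rfl⟩ := hk
    rw [coeff_artinHasseLog_pow]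
    rcases i with _ | i
    · simp [hp.ne_one]
    · rw [if_pos (dvd_pow_self p i.succ_ne_zero), pow_succ, pow_succ,
        Nat.mul_div_cancel _ hp.pos, coeff_artinHasseLog_pow, if_neg, nsmul_eq_mul]
      · field_simp
        simp
      · intro h
        exact hp.ne_one (Nat.eq_one_of_mul_eq_one_left h)
  · push Not at hk
    rw [coeff_artinHasseLog_of_ne hk, if_neg (fun h : k = 1 => hk 0 (by rw [h, pow_zero])),
      smul_zero, add_zero]
    split_ifs with h
    · obtain ⟨m, rfl⟩ := h
      rw [Nat.mul_div_cancel_left _ hp.pos, coeff_artinHasseLog_of_ne]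
      rintro i rfl
      exact hk (i + 1) (by rw [pow_succ'])
    · rfl

/-- The functional equation `E_p(X) ^ p = E_p(X ^ p) exp(p X)`. -/
lemma artinHasse_pow :
    artinHasse p ^ p =
      expand p (Fact.out : p.Prime).ne_zero (artinHasse p) * expOf (p • X) := by
  rw [artinHasse_eq_expOf, ← expOf_nsmul constantCoeff_artinHasseLog, nsmul_artinHasseLog,
    expOf_add, expand_expOf]
  · exact constantCoeff_artinHasseLog
  · rw [constantCoeff_expand, constantCoeff_artinHasseLog]
  · simp

lemma constantCoeff_artinHasse : constantCoeff (artinHasse p) = 1 :=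
  constantCoeff_expOf constantCoeff_artinHasseLog

/-- `P(X) ^ p ≡ P(X ^ p)` modulo `p`, for a polynomial `P` with `p`-integral coefficients. -/
lemma exists_pow_sub_expand_eq (P : Polynomial (pIntegralRat p)) (k : ℕ) :
    ∃ r : pIntegralRat p, (P ^ p).coeff k - (Polynomial.expand _ p P).coeff k = p * r := by
  rw [← Polynomial.coeff_sub]
  refine exists_eq_mul_of_pIntegralRatCast_eq_zero ?_
  rw [← Polynomial.coeff_map, Polynomial.map_sub, Polynomial.map_pow, Polynomial.map_expand,
    ZMod.expand_card, sub_self, Polynomial.coeff_zero]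

/-- The coefficients of the Artin–Hasse exponential are `p`-integral. By Dwork's argument, the
functional equation for `E_p ^ p`, compared in degree `k` with the congruence
`P(X) ^ p ≡ P(X ^ p)` for the truncation `P` of `E_p`, expresses `p` times the coefficient of
degree `k` as a multiple of `p`. -/
theorem coeff_artinHasse_mem (k : ℕ) : coeff k (artinHasse p) ∈ pIntegralRat p := by
  have hp : p.Prime := Fact.out
  have hp0 : (p : ℚ) ≠ 0 := Nat.cast_ne_zero.mpr hp.ne_zero
  induction k using Nat.strong_induction_on with
  | _ k ih =>
    rcases Nat.eq_zero_or_pos k with rfl | hk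
    · rw [coeff_zero_eq_constantCoeff_apply, constantCoeff_artinHasse]
      exact one_mem _
    set E := artinHasse p with hE
    -- the truncation of `E` below degree `k` has `p`-integral coefficients
    let P : Polynomial (pIntegralRat p) :=
      ∑ j : Fin k, Polynomial.monomial j ⟨coeff j E, ih j j.2⟩
    have hP : ∀ j < k, ((P.coeff j : pIntegralRat p) : ℚ) = coeff j E := by
      intro j hj
      simp only [P, Polynomial.finsetSum_coeff, Polynomial.coeff_monomial]
      rw [Finset.sum_eq_single ⟨j, hj⟩]
      · simp
      · intro b _ hb
        rw [if_neg]
        rintro rfl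
        exact hb rfl
      · simp
    let Q : ℚ⟦X⟧ := (P.map (pIntegralRat p).subtype : Polynomial ℚ)
    have hQ : ∀ j, coeff j Q = ((P.coeff j : pIntegralRat p) : ℚ) := by
      intro j
      simp [Q]
    have hQpow : coeff k (Q ^ p) = (((P ^ p).coeff k : pIntegralRat p) : ℚ) := by
      simp only [Q]
      rw [← Polynomial.coe_pow, ← Polynomial.map_pow, Polynomial.coeff_coe, Polynomial.coeff_map]
      rfl
    have hQ0 : constantCoeff Q = 1 := by
      rw [← coeff_zero_eq_constantCoeff_apply, hQ, hP 0 hk, coeff_zero_eq_constantCoeff_apply,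
        constantCoeff_artinHasse]
    obtain ⟨u, hu⟩ : ∃ u, E - Q = X ^ k * u := by
      refine X_pow_dvd_iff.mpr fun j hj => ?_
      rw [map_sub, hQ, hP j hj, sub_self]
    have hPk : P.coeff k = 0 := by
      simp only [P, Polynomial.finsetSum_coeff, Polynomial.coeff_monomial]
      exact Finset.sum_eq_zero fun b _ => if_neg b.2.ne
    have hu0 : constantCoeff u = coeff k E := by
      have := congrArg (coeff k) hu
      rw [map_sub, hQ, hPk, coeff_X_pow_mul', if_pos le_rfl, Nat.sub_self,
        coeff_zero_eq_constantCoeff_apply] at this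
      simpa using this.symm
    -- the coefficient of `E ^ p` in degree `k`
    have hleft : coeff k (E ^ p) = coeff k (Q ^ p) + p * coeff k E := by
      obtain ⟨c, hc⟩ := Polynomial.powAddExpansion Q (X ^ k * u) p
      rw [show E ^ p = (Q + X ^ k * u) ^ p by rw [← hu, add_sub_cancel], hc, map_add, map_add,
        show (p : ℚ⟦X⟧) * Q ^ (p - 1) * (X ^ k * u) =
          X ^ k * ((p : ℚ⟦X⟧) * Q ^ (p - 1) * u) by ring,
        show c * (X ^ k * u) ^ 2 = X ^ k * (X ^ k * (c * u ^ 2)) by ring,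
        coeff_X_pow_mul', coeff_X_pow_mul', if_pos le_rfl, if_pos le_rfl, Nat.sub_self,
        coeff_zero_eq_constantCoeff_apply, coeff_zero_eq_constantCoeff_apply]
      simp [hQ0, hu0, hk.ne']
    -- the same coefficient by the functional equation
    have hright : coeff k (E ^ p) = (((Polynomial.expand _ p P).coeff k : pIntegralRat p) : ℚ) +
        ∑ x ∈ (Finset.HasAntidiagonal.antidiagonal k).erase (k, 0),
          coeff x.1 (expand p hp.ne_zero E) * ((p : ℚ) ^ x.2 / x.2.factorial) := by
      rw [hE, artinHasse_pow, coeff_mul, ← Finset.add_sum_erase _ _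
        (show (k, 0) ∈ Finset.HasAntidiagonal.antidiagonal k by simp)]
      simp only [coeff_expOf_nsmul_X]
      congr 1
      rw [pow_zero, Nat.factorial_zero, Nat.cast_one, div_one, mul_one, coeff_expand,
        Polynomial.coeff_expand hp.pos]
      split_ifs
      · rw [hP _ (Nat.div_lt_self hk hp.one_lt)]
      · rfl
    have hsum : (∑ x ∈ (Finset.HasAntidiagonal.antidiagonal k).erase (k, 0),
        coeff x.1 (expand p hp.ne_zero E) * ((p : ℚ) ^ x.2 / x.2.factorial)) / p ∈
          pIntegralRat p := by
      rw [Finset.sum_div]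
      refine sum_mem fun x hx => ?_
      rw [Finset.mem_erase, Finset.HasAntidiagonal.mem_antidiagonal] at hx
      have hx2 : x.2 ≠ 0 := by
        intro h0
        exact hx.1 (Prod.ext (by simpa [h0] using hx.2) h0)
      rw [mul_div_assoc]
      refine mul_mem ?_ (pow_div_factorial_div_mem_pIntegralRat hx2)
      rw [coeff_expand]
      split_ifs
      · exact ih _ ((Nat.div_le_self _ _).trans_lt (by omega))
      · exact zero_mem _
    obtain ⟨r, hr⟩ := exists_pow_sub_expand_eq P k
    have hr' := congrArg (fun z : pIntegralRat p => (z : ℚ)) hr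
    simp only [AddSubgroupClass.coe_sub, MulMemClass.coe_mul, SubringClass.coe_natCast] at hr'
    have key : coeff k E = (∑ x ∈ (Finset.HasAntidiagonal.antidiagonal k).erase (k, 0),
        coeff x.1 (expand p hp.ne_zero E) * ((p : ℚ) ^ x.2 / x.2.factorial)) / p - r := by
      rw [eq_sub_iff_add_eq, eq_div_iff hp0]
      rw [hleft, hQpow] at hright
      linarith
    rw [key]
    exact sub_mem hsum r.2

lemma X_mul_derivative_artinHasse :
    X * d⁄dX ℚ (artinHasse p) = primePowSeries ℚ p * artinHasse p := by
  rw [artinHasse_eq_expOf, derivative_expOf constantCoeff_artinHasseLog, ← mul_assoc]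
  congr 1
  ext k
  rcases k with _ | k
  · rw [coeff_zero_X_mul, primePowSeries, coeff_mk, if_neg]
    rintro ⟨i, hi⟩
    exact (pow_pos (Fact.out : p.Prime).pos i).ne hi
  · rw [coeff_succ_X_mul, coeff_derivative, primePowSeries, coeff_mk, artinHasseLog, coeff_mk]
    split_ifs
    · push_cast
      exact inv_mul_cancel₀ (by positivity)
    · rw [zero_mul]

/-- The reduction modulo `p` of the Artin–Hasse exponential. -/
noncomputable def artinHasseMod (F : Type*) [Field F] (p : ℕ) : F⟦X⟧ :=
  PowerSeries.mk fun k => ((coeff k (artinHasse p) : ℚ) : F)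

variable (F : Type*) [Field F]

lemma constantCoeff_artinHasseMod : constantCoeff (artinHasseMod F p) = 1 := by
  rw [← coeff_zero_eq_constantCoeff_apply, artinHasseMod, coeff_mk,
    coeff_zero_eq_constantCoeff_apply, constantCoeff_artinHasse, Rat.cast_one]

/-- The differential equation `X E_p'(X) = (∑ X ^ (p ^ i)) E_p(X)` modulo `p`. -/
theorem natCast_mul_coeff_artinHasseMod [CharP F p] (k : ℕ) :
    (k : F) * coeff k (artinHasseMod F p) =
      coeff k (primePowSeries F p * artinHasseMod F p) := by
  have h := congrArg (coeff k) (X_mul_derivative_artinHasse (p := p))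
  have hk : coeff k (X * d⁄dX ℚ (artinHasse p)) = (k : ℚ) * coeff k (artinHasse p) := by
    rcases k with _ | k
    · simp
    · rw [coeff_succ_X_mul, coeff_derivative, mul_comm]
      push_cast
      rfl
  rw [hk, coeff_mul] at h
  have hR : (k : pIntegralRat p) * ⟨coeff k (artinHasse p), coeff_artinHasse_mem k⟩ =
      ∑ x ∈ Finset.HasAntidiagonal.antidiagonal k, coeff x.1 (primePowSeries (pIntegralRat p) p) *
        ⟨coeff x.2 (artinHasse p), coeff_artinHasse_mem x.2⟩ := by
    apply Subtype.ext
    rw [MulMemClass.coe_mul, SubringClass.coe_natCast, h, AddSubmonoidClass.coe_finsetSum]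
    refine Finset.sum_congr rfl fun x _ => ?_
    rw [MulMemClass.coe_mul, map_primePowSeries (pIntegralRat p).subtype]
    rfl
  have hF := congrArg (pIntegralRatCast F) hR
  rw [map_mul, map_natCast, map_sum] at hF
  rw [coeff_mul, artinHasseMod, coeff_mk]
  refine hF.trans (Finset.sum_congr rfl fun x _ => ?_)
  rw [map_mul, ← map_primePowSeries, coeff_mk]
  rfl

end ArtinHasse

/-! ### The addition law of the Artin–Hasse exponential modulo `p` -/

section AdditionLaw

open PowerSeries

lemma Polynomial.aeval_trunc_of_pow_eq_zero {F A : Type*} [CommRing F] [Ring A] [Algebra F A]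
    {T : A} {M : ℕ} (hT : T ^ M = 0) (q : Polynomial F) :
    Polynomial.aeval T (trunc M (q : F⟦X⟧)) = Polynomial.aeval T q := by
  obtain ⟨r, hr⟩ : Polynomial.X ^ M ∣ q - trunc M (q : F⟦X⟧) := by
    refine Polynomial.X_pow_dvd_iff.mpr fun d hd => ?_
    rw [Polynomial.coeff_sub, coeff_trunc, if_pos hd, Polynomial.coeff_coe, sub_self]
  have h := congrArg (Polynomial.aeval T) hr
  rw [map_mul, map_pow, Polynomial.aeval_X, hT, zero_mul, map_sub, sub_eq_zero] at h
  exact h.symm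

lemma PowerSeries.aeval_trunc_mul {F A : Type*} [CommRing F] [Ring A] [Algebra F A]
    {T : A} {M : ℕ} (hT : T ^ M = 0) (f g : F⟦X⟧) :
    Polynomial.aeval T (trunc M (f * g)) =
      Polynomial.aeval T (trunc M f) * Polynomial.aeval T (trunc M g) := by
  rw [← trunc_trunc_mul_trunc, ← Polynomial.coe_mul,
    Polynomial.aeval_trunc_of_pow_eq_zero hT, map_mul]

lemma PowerSeries.aeval_trunc_eq_sum {F A : Type*} [CommRing F] [Ring A] [Algebra F A]
    (T : A) (M : ℕ) (f : F⟦X⟧) :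
    Polynomial.aeval T (trunc M f) = ∑ k ∈ Finset.range M, coeff k f • T ^ k := by
  rw [Polynomial.aeval_def, eval₂_trunc_eq_sum_range]
  simp only [Algebra.smul_def]

variable (F : Type*) {R : Type*} [Field F] [CommRing R] [Algebra F R]

variable {F} in
/-- The series `f (c t)` in the indeterminate `t`. -/
noncomputable def scaledSeries (f : F⟦X⟧) (c : R) : R⟦X⟧ :=
  rescale c (PowerSeries.map (algebraMap F R) f)

variable {F} in
lemma coeff_scaledSeries (f : F⟦X⟧) (c : R) (k : ℕ) :
    coeff k (scaledSeries f c) = coeff k f • c ^ k := by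
  rw [scaledSeries, coeff_rescale, coeff_map, Algebra.smul_def, mul_comm]

lemma coeff_X_mul_derivative (f : R⟦X⟧) (k : ℕ) :
    coeff k (X * d⁄dX R f) = (k : R) * coeff k f := by
  rcases k with _ | k
  · simp
  · rw [coeff_succ_X_mul, coeff_derivative, mul_comm]
    push_cast
    rfl

variable (p : ℕ)

/-- The homogeneous components of the series `E_p(X) E_p(Y) / E_p(X + Y)`, at `X = a`, `Y = b`,
are the coefficients of this power series in a new indeterminate `t`. -/
noncomputable def artinHasseCocycle (a b : R) : R⟦X⟧ :=
  scaledSeries (artinHasseMod F p) a * scaledSeries (artinHasseMod F p) b *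
    scaledSeries (artinHasseMod F p)⁻¹ (a + b)

lemma coeff_artinHasseCocycle (a b : R) (k : ℕ) :
    coeff k (artinHasseCocycle F p a b) =
      ∑ x ∈ Finset.HasAntidiagonal.antidiagonal k,
        ∑ y ∈ Finset.HasAntidiagonal.antidiagonal x.1,
          (coeff y.1 (artinHasseMod F p) * coeff y.2 (artinHasseMod F p) *
            coeff x.2 (artinHasseMod F p)⁻¹) • ((a + b) ^ x.2 * (a ^ y.1 * b ^ y.2)) := by
  rw [artinHasseCocycle, coeff_mul]
  refine Finset.sum_congr rfl fun x _ => ?_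
  rw [coeff_mul, Finset.sum_mul]
  refine Finset.sum_congr rfl fun y _ => ?_
  simp only [coeff_scaledSeries, Algebra.smul_def, map_mul]
  ring

variable [Fact p.Prime] [CharP F p]

lemma X_mul_derivative_scaledSeries_artinHasseMod (c : R) :
    X * d⁄dX R (scaledSeries (artinHasseMod F p) c) =
      scaledSeries (primePowSeries F p) c * scaledSeries (artinHasseMod F p) c := by
  ext k
  rw [coeff_X_mul_derivative, scaledSeries, scaledSeries, ← map_mul, ← map_mul, coeff_rescale,
    coeff_rescale, coeff_map, coeff_map, ← natCast_mul_coeff_artinHasseMod, map_mul, map_natCast]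
  ring

lemma scaledSeries_primePowSeries_add (a b : R) :
    scaledSeries (primePowSeries F p) (a + b) =
      scaledSeries (primePowSeries F p) a + scaledSeries (primePowSeries F p) b := by
  ext k
  rw [map_add, coeff_scaledSeries, coeff_scaledSeries, coeff_scaledSeries, ← smul_add]
  rw [primePowSeries, coeff_mk]
  split_ifs with h
  · obtain ⟨i, rfl⟩ := h
    rcases subsingleton_or_nontrivial R with _ | _
    · exact Subsingleton.elim _ _
    have : CharP R p := charP_of_injective_algebraMap (algebraMap F R).injective p
    rw [add_pow_char_pow]
  · simp

/-- The components of `E_p(X) E_p(Y) / E_p(X + Y)` in degrees not divisible by `p` vanish: the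
logarithmic derivative `∑ X ^ (p ^ i)` of `E_p` is additive in characteristic `p`, so
`t d/dt` kills the series. -/
theorem coeff_artinHasseCocycle_eq_zero (a b : R) {k : ℕ} (hk : ¬ p ∣ k) :
    coeff k (artinHasseCocycle F p a b) = 0 := by
  set A := scaledSeries (artinHasseMod F p) a with hA
  set B := scaledSeries (artinHasseMod F p) b with hB
  set E := scaledSeries (artinHasseMod F p) (a + b) with hE
  set V := scaledSeries (artinHasseMod F p)⁻¹ (a + b) with hV
  set La := scaledSeries (primePowSeries F p) a with hLa
  set Lb := scaledSeries (primePowSeries F p) b with hLb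
  have hEV : E * V = 1 := by
    rw [hE, hV, scaledSeries, scaledSeries, ← map_mul, ← map_mul, PowerSeries.mul_inv_cancel,
      map_one, map_one]
    rw [constantCoeff_artinHasseMod]
    exact one_ne_zero
  have h1 : X * d⁄dX R A = La * A := X_mul_derivative_scaledSeries_artinHasseMod F p a
  have h2 : X * d⁄dX R B = Lb * B := X_mul_derivative_scaledSeries_artinHasseMod F p b
  have h3 : X * d⁄dX R E = (La + Lb) * E := by
    rw [hLa, hLb, ← scaledSeries_primePowSeries_add]
    exact X_mul_derivative_scaledSeries_artinHasseMod F p (a + b)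
  have h4 : X * d⁄dX R V = - (La + Lb) * V := by
    have h := congrArg (fun f => X * d⁄dX R f) hEV
    simp only [Derivation.leibniz, smul_eq_mul, Derivation.map_one_eq_zero, mul_zero] at h
    calc X * d⁄dX R V = E * V * (X * d⁄dX R V) := by rw [hEV, one_mul]
      _ = V * (X * (E * d⁄dX R V + V * d⁄dX R E)) - V * V * (X * d⁄dX R E) := by ring
      _ = - (La + Lb) * (E * V) * V := by rw [h, h3]; ring
      _ = - (La + Lb) * V := by rw [hEV]; ring
  have h5 : X * d⁄dX R (A * B * V) = 0 := by
    simp only [Derivation.leibniz, smul_eq_mul]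
    calc X * (A * B * d⁄dX R V + V * (A * d⁄dX R B + B * d⁄dX R A))
        = A * B * (X * d⁄dX R V) + V * (A * (X * d⁄dX R B) + B * (X * d⁄dX R A)) := by ring
      _ = 0 := by rw [h1, h2, h4]; ring
  have h6 := coeff_X_mul_derivative (A * B * V) k
  rw [h5, map_zero] at h6
  have hkF : (k : F) ≠ 0 := by rwa [Ne, CharP.cast_eq_zero_iff F p]
  have hkR : IsUnit (k : R) := by
    have := (IsUnit.mk0 _ hkF).map (algebraMap F R)
    rwa [map_natCast] at this
  exact hkR.mul_right_eq_zero.mp h6.symm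

lemma eval_one_trunc_scaledSeries (f : F⟦X⟧) (c : R) (M : ℕ) :
    (trunc M (scaledSeries f c)).eval 1 = Polynomial.aeval c (trunc M f) := by
  rw [aeval_trunc_eq_sum, Polynomial.eval, eval₂_trunc_eq_sum_range]
  simp [coeff_scaledSeries]

lemma coe_trunc_scaledSeries (f : F⟦X⟧) {c : R} {M : ℕ} (hc : c ^ M = 0) :
    (trunc M (scaledSeries f c) : R⟦X⟧) = scaledSeries f c := by
  ext k
  rw [Polynomial.coeff_coe, coeff_trunc]
  split_ifs with h
  · rfl
  · rw [coeff_scaledSeries, pow_eq_zero_of_le (not_lt.mp h) hc, smul_zero]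

/-- The addition law of the Artin–Hasse exponential at nilpotent elements: the quotient
`E_p(a) E_p(b) / E_p(a + b)` is a sum of components of degrees divisible by `p`. -/
theorem artinHasse_mul_artinHasse_mul_inv {a b : R} {M : ℕ} (ha : a ^ M = 0)
    (hb : b ^ M = 0) (hab : (a + b) ^ M = 0) :
    ∃ N : ℕ, Polynomial.aeval a (trunc M (artinHasseMod F p)) *
        Polynomial.aeval b (trunc M (artinHasseMod F p)) *
        Polynomial.aeval (a + b) (trunc M (artinHasseMod F p)⁻¹) =
      ∑ k ∈ (Finset.range N).filter (p ∣ ·), coeff k (artinHasseCocycle F p a b) := by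
  set P := trunc M (scaledSeries (artinHasseMod F p) a) *
    trunc M (scaledSeries (artinHasseMod F p) b) *
    trunc M (scaledSeries (artinHasseMod F p)⁻¹ (a + b)) with hP
  have hPG : (P : R⟦X⟧) = artinHasseCocycle F p a b := by
    rw [hP, Polynomial.coe_mul, Polynomial.coe_mul, coe_trunc_scaledSeries _ _ ha,
      coe_trunc_scaledSeries _ _ hb, coe_trunc_scaledSeries _ _ hab, artinHasseCocycle]
  refine ⟨P.natDegree + 1, ?_⟩
  rw [← eval_one_trunc_scaledSeries, ← eval_one_trunc_scaledSeries,
    ← eval_one_trunc_scaledSeries, ← Polynomial.eval_mul, ← Polynomial.eval_mul, ← hP,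
    Polynomial.eval_eq_sum_range, Finset.sum_filter]
  refine Finset.sum_congr rfl fun k _ => ?_
  rw [one_pow, mul_one, ← Polynomial.coeff_coe, hPG]
  split_ifs with h
  · rfl
  · exact coeff_artinHasseCocycle_eq_zero F p a b h

end AdditionLaw

/-! ### Switching a grading by a nilpotent derivation -/

section Switching

open PowerSeries
open scoped TensorProduct IsMulCommutative

variable {F : Type*} [Field F] {L : Type*} [LieRing L] [LieAlgebra F L]

lemma artinHasseEnd_eq_aeval {V : Type*} [AddCommGroup V] [Module F V] (p : ℕ)
    {T : Module.End F V} {M : ℕ} (hT : T ^ M = 0) :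
    artinHasseEnd p T = Polynomial.aeval T (trunc M (artinHasseMod F p)) := by
  rw [aeval_trunc_eq_sum, artinHasseEnd]
  have hM : nilpotencyClass T ≤ M := Nat.sInf_le hT
  simp only [artinHasseMod, coeff_mk]
  refine Finset.sum_subset (Finset.range_mono hM) fun k _ hk => ?_
  rw [pow_eq_zero_of_le (not_lt.mp fun h => hk (Finset.mem_range.mpr h))
    (pow_nilpotencyClass ⟨M, hT⟩), smul_zero]

/-- For a derivation `T`, the bracket intertwines `T ⊗ 1 + 1 ⊗ T` and `T`. -/
lemma toModuleHom_comp_pow {T : Module.End F L}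
    (hT : ∀ x y : L, T ⁅x, y⁆ = ⁅T x, y⁆ + ⁅x, T y⁆) (l : ℕ) (z : L ⊗[F] L) :
    (LieModule.toModuleHom F L L : L ⊗[F] L →ₗ[F] L) (((T.rTensor L + T.lTensor L) ^ l) z) =
      (T ^ l) ((LieModule.toModuleHom F L L : L ⊗[F] L →ₗ[F] L) z) := by
  have h1 : (LieModule.toModuleHom F L L : L ⊗[F] L →ₗ[F] L) ∘ₗ (T.rTensor L + T.lTensor L) =
      T ∘ₗ (LieModule.toModuleHom F L L : L ⊗[F] L →ₗ[F] L) := by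
    refine TensorProduct.ext' fun x y => ?_
    simp [hT]
  induction l generalizing z with
  | zero => rfl
  | succ l ih =>
    rw [pow_succ, Module.End.mul_apply, ih, pow_succ, Module.End.mul_apply]
    exact congrArg _ (LinearMap.congr_fun h1 z)

lemma commute_rTensor_lTensor (T : Module.End F L) :
    Commute (T.rTensor L : Module.End F (L ⊗[F] L)) (T.lTensor L) :=
  (LinearMap.rTensor_comp_lTensor (f := T) (g := T)).trans
    (LinearMap.lTensor_comp_rTensor (f := T) (g := T)).symm

/-- In characteristic `p`, the `p`-th powers of a derivation are derivations. -/
lemma pow_char_pow_lie (p : ℕ) [Fact p.Prime] [CharP F p] {T : Module.End F L}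
    (hT : ∀ x y : L, T ⁅x, y⁆ = ⁅T x, y⁆ + ⁅x, T y⁆) (s : ℕ) (x y : L) :
    (T ^ p ^ s) ⁅x, y⁆ = ⁅(T ^ p ^ s) x, y⁆ + ⁅x, (T ^ p ^ s) y⁆ := by
  have h : (T.rTensor L + T.lTensor L : Module.End F (L ⊗[F] L)) ^ p ^ s =
      (T ^ p ^ s).rTensor L + (T ^ p ^ s).lTensor L := by
    rcases subsingleton_or_nontrivial (Module.End F (L ⊗[F] L)) with _ | _
    · exact Subsingleton.elim _ _
    have : CharP (Module.End F (L ⊗[F] L)) p :=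
      charP_of_injective_algebraMap (algebraMap F (Module.End F (L ⊗[F] L))).injective p
    rw [add_pow_char_pow_of_commute _ _ (commute_rTensor_lTensor T), LinearMap.rTensor_pow,
      LinearMap.lTensor_pow]
  have h' := toModuleHom_comp_pow hT (p ^ s) (x ⊗ₜ[F] y)
  rw [h] at h'
  simpa using h'.symm

variable {G : Type*} [AddCommGroup G] {Γ : G → Submodule F L}

lemma pow_mem_of_map_le {T : Module.End F L} {d : G} (hT : ∀ g, (Γ g).map T ≤ Γ (g - d))
    (k : ℕ) {g : G} {x : L} (hx : x ∈ Γ g) : (T ^ k) x ∈ Γ (g - k • d) := by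
  induction k with
  | zero => simpa using hx
  | succ k ih =>
    rw [pow_succ', Module.End.mul_apply, succ_nsmul, ← sub_sub]
    exact hT _ (Submodule.mem_map_of_mem ih)

/-- The core of grading switching: `E_p(-)⁻¹` of a bracket `[E_p(T) x, E_p(T) y]` of images of
homogeneous elements is homogeneous, because the addition law of `E_p` only involves degrees
divisible by `p`. -/
theorem aeval_inv_lie_artinHasseEnd_mem (p : ℕ) [Fact p.Prime] [CharP F p]
    (hΓ : IsLieGrading Γ) {T : Module.End F L}
    (hT : ∀ x y : L, T ⁅x, y⁆ = ⁅T x, y⁆ + ⁅x, T y⁆) {d : G} (hd : p • d = 0)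
    (hTd : ∀ g, (Γ g).map T ≤ Γ (g - d)) {M : ℕ} (hM : T ^ M = 0)
    (hM2 : (T.rTensor L + T.lTensor L : Module.End F (L ⊗[F] L)) ^ M = 0)
    {g h : G} {x y : L} (hx : x ∈ Γ g) (hy : y ∈ Γ h) :
    Polynomial.aeval T (trunc M (artinHasseMod F p)⁻¹)
      ⁅artinHasseEnd p T x, artinHasseEnd p T y⁆ ∈ Γ (g + h) := by
  set m := (LieModule.toModuleHom F L L : L ⊗[F] L →ₗ[F] L) with hm
  let A : Module.End F (L ⊗[F] L) := T.rTensor L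
  let B : Module.End F (L ⊗[F] L) := T.lTensor L
  have hAB : Commute A B := commute_rTensor_lTensor T
  have hA : A ^ M = 0 := by
    rw [show A ^ M = (T ^ M).rTensor L from LinearMap.rTensor_pow _ _, hM, LinearMap.rTensor_zero]
  have hB : B ^ M = 0 := by
    rw [show B ^ M = (T ^ M).lTensor L from LinearMap.lTensor_pow _ _, hM, LinearMap.lTensor_zero]
  -- the addition law is applied in the commutative algebra generated by `A` and `B`
  let S := Algebra.adjoin F {A, B}
  have : IsMulCommutative S := Algebra.isMulCommutative_adjoin F (by
    rintro u (rfl | rfl) v (rfl | rfl)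
    · rfl
    · exact hAB
    · exact hAB.symm
    · rfl)
  let a : S := ⟨A, Algebra.subset_adjoin (by simp)⟩
  let b : S := ⟨B, Algebra.subset_adjoin (by simp)⟩
  obtain ⟨N, hN⟩ := artinHasse_mul_artinHasse_mul_inv (R := S) F p (a := a) (b := b) (M := M)
    (Subtype.ext hA) (Subtype.ext hB) (Subtype.ext hM2)
  rw [mul_comm] at hN
  have hN' := congrArg (fun z => m (S.val z (x ⊗ₜ[F] y))) hN
  have hval : ∀ (c : S) (q : Polynomial F), S.val (Polynomial.aeval c q) =
      Polynomial.aeval (c : Module.End F (L ⊗[F] L)) q := fun c q =>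
    (Polynomial.aeval_algHom_apply S.val c q).symm
  have hmV : ∀ z, m (Polynomial.aeval (A + B) (trunc M (artinHasseMod F p)⁻¹) z) =
      Polynomial.aeval T (trunc M (artinHasseMod F p)⁻¹) (m z) := by
    intro z
    rw [aeval_trunc_eq_sum, aeval_trunc_eq_sum, LinearMap.sum_apply, LinearMap.sum_apply, map_sum]
    refine Finset.sum_congr rfl fun k _ => ?_
    rw [LinearMap.smul_apply, LinearMap.smul_apply, map_smul, toModuleHom_comp_pow hT]
  have hAE : ∀ q : Polynomial F, Polynomial.aeval A q = (Polynomial.aeval T q).rTensor L :=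
    fun q => Polynomial.aeval_algHom_apply (Module.End.rTensorAlgHom F L L) T q
  have hBE : ∀ q : Polynomial F, Polynomial.aeval B q = (Polynomial.aeval T q).lTensor L :=
    fun q => Polynomial.aeval_algHom_apply (Module.End.lTensorAlgHom F L L) T q
  have hleft : m (S.val (Polynomial.aeval (a + b) (trunc M (artinHasseMod F p)⁻¹) *
      (Polynomial.aeval a (trunc M (artinHasseMod F p)) *
        Polynomial.aeval b (trunc M (artinHasseMod F p)))) (x ⊗ₜ[F] y)) =
      Polynomial.aeval T (trunc M (artinHasseMod F p)⁻¹)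
        ⁅artinHasseEnd p T x, artinHasseEnd p T y⁆ := by
    rw [map_mul, map_mul, hval, hval, hval, Module.End.mul_apply, Module.End.mul_apply]
    rw [show ((a + b : S) : Module.End F (L ⊗[F] L)) = A + B from rfl, hmV,
      show (a : Module.End F (L ⊗[F] L)) = A from rfl,
      show (b : Module.End F (L ⊗[F] L)) = B from rfl, hAE, hBE, LinearMap.lTensor_tmul,
      LinearMap.rTensor_tmul, artinHasseEnd_eq_aeval p hM]
    rfl
  rw [← hleft]
  refine (congrArg (· ∈ Γ (g + h)) hN').mpr ?_
  rw [map_sum, LinearMap.sum_apply, map_sum]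
  refine sum_mem fun k hk => ?_
  obtain ⟨c, rfl⟩ := (Finset.mem_filter.mp hk).2
  rw [coeff_artinHasseCocycle, map_sum, LinearMap.sum_apply, map_sum]
  refine sum_mem fun u hu => ?_
  rw [map_sum, LinearMap.sum_apply, map_sum]
  refine sum_mem fun v hv => ?_
  rw [Finset.HasAntidiagonal.mem_antidiagonal] at hu hv
  rw [map_smul, LinearMap.smul_apply, map_smul]
  refine Submodule.smul_mem _ _ ?_
  have hmono : m (S.val ((a + b) ^ u.2 * (a ^ v.1 * b ^ v.2)) (x ⊗ₜ[F] y)) =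
      (T ^ u.2) ⁅(T ^ v.1) x, (T ^ v.2) y⁆ := by
    rw [map_mul, map_mul, map_pow, map_pow, map_pow, Module.End.mul_apply, Module.End.mul_apply]
    rw [show S.val (a + b) = T.rTensor L + T.lTensor L from rfl, toModuleHom_comp_pow hT,
      show S.val a = T.rTensor L from rfl, show S.val b = T.lTensor L from rfl,
      LinearMap.rTensor_pow, LinearMap.lTensor_pow, LinearMap.lTensor_tmul,
      LinearMap.rTensor_tmul]
    rfl
  rw [hmono]
  have hmem := pow_mem_of_map_le hTd u.2 (hΓ.lie_mem _ _ _ (pow_mem_of_map_le hTd v.1 hx) _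
    (pow_mem_of_map_le hTd v.2 hy))
  have hdeg : g - v.1 • d + (h - v.2 • d) - u.2 • d = g + h := by
    have h0 : v.1 • d + v.2 • d + u.2 • d = 0 := by
      rw [← add_smul, ← add_smul, hv, hu, mul_comm, mul_smul, hd, smul_zero]
    rw [← sub_zero (g + h), ← h0]
    abel
  rwa [hdeg] at hmem

lemma aeval_inv_artinHasseEnd {V : Type*} [AddCommGroup V] [Module F V] (p : ℕ) [Fact p.Prime]
    {T : Module.End F V} {M : ℕ} (hM : T ^ M = 0) :
    Polynomial.aeval T (trunc M (artinHasseMod F p)⁻¹) * artinHasseEnd p T = 1 ∧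
      artinHasseEnd p T * Polynomial.aeval T (trunc M (artinHasseMod F p)⁻¹) = 1 := by
  have h0 : constantCoeff (artinHasseMod F p) ≠ 0 := by
    rw [constantCoeff_artinHasseMod]
    exact one_ne_zero
  have h1 : Polynomial.aeval T (trunc M (1 : F⟦X⟧)) = 1 := by
    have h := Polynomial.aeval_trunc_of_pow_eq_zero hM (1 : Polynomial F)
    rwa [Polynomial.coe_one, map_one (Polynomial.aeval T)] at h
  rw [artinHasseEnd_eq_aeval p hM, ← aeval_trunc_mul hM, ← aeval_trunc_mul hM,
    PowerSeries.inv_mul_cancel _ h0, PowerSeries.mul_inv_cancel _ h0]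
  exact ⟨h1, h1⟩

/-- `E_p(T)` as a linear automorphism. -/
noncomputable def artinHasseEquiv {V : Type*} [AddCommGroup V] [Module F V] (p : ℕ)
    [Fact p.Prime] {T : Module.End F V} (hT : IsNilpotent T) : V ≃ₗ[F] V :=
  LinearEquiv.ofLinearMap (artinHasseEnd p T)
    (Polynomial.aeval T (trunc hT.choose (artinHasseMod F p)⁻¹))
    (aeval_inv_artinHasseEnd p hT.choose_spec).2 (aeval_inv_artinHasseEnd p hT.choose_spec).1

/-- Grading switching: the images of the components of a grading under the Artin–Hasse
exponential of a nilpotent derivation of degree `-d`, where `p d = 0`, form a grading. -/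
theorem IsLieGrading.map_artinHasseEnd (p : ℕ) [Fact p.Prime] [CharP F p]
    (hΓ : IsLieGrading Γ) {T : Module.End F L}
    (hT : ∀ x y : L, T ⁅x, y⁆ = ⁅T x, y⁆ + ⁅x, T y⁆) {d : G} (hd : p • d = 0)
    (hTd : ∀ g, (Γ g).map T ≤ Γ (g - d)) (hnil : IsNilpotent T) :
    IsLieGrading fun g => (Γ g).map (artinHasseEnd p T) := by
  classical
  refine ⟨?_, ?_⟩
  · have h := hΓ.isInternal
    rw [DirectSum.isInternal_submodule_iff_iSupIndep_and_iSup_eq_top] at h ⊢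
    refine ⟨h.1.map_orderIso (Submodule.orderIsoMapComap (artinHasseEquiv p hnil)), ?_⟩
    rw [← Submodule.map_iSup, h.2, Submodule.map_top]
    exact LinearMap.range_eq_top.mpr (artinHasseEquiv p hnil).surjective
  · obtain ⟨N, hN⟩ := hnil
    obtain ⟨N', hN'⟩ : IsNilpotent (T.rTensor L + T.lTensor L : Module.End F (L ⊗[F] L)) := by
      refine (commute_rTensor_lTensor T).isNilpotent_add ⟨N, ?_⟩ ⟨N, ?_⟩
      · rw [LinearMap.rTensor_pow, hN, LinearMap.rTensor_zero]
      · rw [LinearMap.lTensor_pow, hN, LinearMap.lTensor_zero]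
    have hM := pow_eq_zero_of_le (Nat.le_add_right N N') hN
    have hM2 := pow_eq_zero_of_le (Nat.le_add_left N' N) hN'
    rintro g h _ ⟨x, hx, rfl⟩ _ ⟨y, hy, rfl⟩
    refine ⟨_, aeval_inv_lie_artinHasseEnd_mem p hΓ hT hd hTd hM hM2 hx hy, ?_⟩
    exact LinearMap.congr_fun (aeval_inv_artinHasseEnd p hM).2 _

end Switching

/-! ### Gradings given by the degrees of basis vectors -/

section BasisGrading

variable {F : Type*} [Field F] {L : Type*} [LieRing L] [LieAlgebra F L]

lemma iSupIndep_span_image_fiber {ι G : Type*} (b : Module.Basis ι F L) (deg : ι → G) :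
    iSupIndep fun g => Submodule.span F (b '' {i | deg i = g}) := by
  intro g
  have h : (⨆ (j) (_ : j ≠ g), Submodule.span F (b '' {i | deg i = j})) ≤
      Submodule.span F (b '' {i | deg i ≠ g}) :=
    iSup₂_le fun j hj => Submodule.span_mono <| Set.image_mono fun i hi => by
      rw [Set.mem_ofPred_eq] at hi ⊢
      rwa [hi]
  refine Disjoint.mono_right h (b.linearIndependent.disjoint_span_image ?_)
  exact Set.disjoint_left.mpr fun i hi hi' => hi' hi

lemma iSup_span_image_fiber {ι G : Type*} (b : Module.Basis ι F L) (deg : ι → G) :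
    ⨆ g, Submodule.span F (b '' {i | deg i = g}) = ⊤ := by
  rw [← Submodule.span_iUnion, ← b.span_eq]
  congr 1
  ext x
  simp

/-- The components of different degrees of a grading have no common nonzero element. -/
lemma IsLieGrading.eq_of_mem {G : Type*} [AddCommGroup G] {Γ : G → Submodule F L}
    (hΓ : IsLieGrading Γ) {g h : G} {x : L} (hg : x ∈ Γ g) (hh : x ∈ Γ h) (hx : x ≠ 0) :
    g = h := by
  classical
  have hi := hΓ.isInternal
  rw [DirectSum.isInternal_submodule_iff_iSupIndep_and_iSup_eq_top] at hi
  by_contra hne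
  exact hx (Submodule.disjoint_def.mp (hi.1.pairwiseDisjoint hne) x hg hh)

lemma IsLieGrading.iSup_eq_top {G : Type*} [AddCommGroup G] {Γ : G → Submodule F L}
    (hΓ : IsLieGrading Γ) : ⨆ g, Γ g = ⊤ := by
  classical
  exact hΓ.isInternal.submodule_iSup_eq_top

lemma IsLieGrading.map_lieEquiv {G : Type*} [AddCommGroup G] {Γ : G → Submodule F L}
    (hΓ : IsLieGrading Γ) (φ : L ≃ₗ⁅F⁆ L) :
    IsLieGrading fun g => (Γ g).map (φ : L →ₗ[F] L) := by
  classical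
  refine ⟨?_, ?_⟩
  · have h := hΓ.isInternal
    rw [DirectSum.isInternal_submodule_iff_iSupIndep_and_iSup_eq_top] at h ⊢
    refine ⟨h.1.map_orderIso (Submodule.orderIsoMapComap φ.toLinearEquiv), ?_⟩
    rw [← Submodule.map_iSup, h.2, Submodule.map_top]
    exact LinearMap.range_eq_top.mpr φ.surjective
  · rintro g h _ ⟨x, hx, rfl⟩ _ ⟨y, hy, rfl⟩
    exact ⟨_, hΓ.lie_mem _ _ _ hx _ hy, φ.map_lie x y⟩

end BasisGrading

/-! ### The Zassenhaus algebra -/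

section DivPowProducts

variable {F : Type*} [Field F] {p n : ℕ}

/-- A product `x^(i) ∂(x^(j))` is a multiple of `x^(i + j - 1)`. The first clause handles
`i = j = 0`, where the truncated exponent `i + j - 1` is not the degree. -/
lemma DivPow.exists_X_mul_derivMap_X {i j : ℕ} (hj : j < p ^ n) :
    ∃ c : F, (i + j = 0 → c = 0) ∧
      DivPow.X F p n i * DivPow.derivMap F p n (DivPow.X F p n j) =
        c • DivPow.X F p n (i + j - 1) := by
  rw [DivPow.derivMap_X F hj]
  split_ifs with h0
  · exact ⟨0, fun _ => rfl, by rw [mul_zero, zero_smul]⟩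
  · refine ⟨((i + (j - 1)).choose i : F), by omega, ?_⟩
    rw [DivPow.X_mul_X, Nat.add_sub_assoc (by omega)]

end DivPowProducts

namespace Zassenhaus

variable (F : Type*) [Field F] (p n : ℕ) [Fact p.Prime] [CharP F p]

/-- The linear map `f ↦ f ∂`. -/
noncomputable def ofDivPow : DivPow F p n →ₗ[F] Zassenhaus F p n where
  toFun f := ⟨f • DivPow.partialD F p n, f, rfl⟩
  map_add' f g := Subtype.ext (add_smul f g _)
  map_smul' c f := Subtype.ext (smul_assoc c f _)

variable {F p n}

lemma ofDivPow_X (k : ℕ) : ofDivPow F p n (DivPow.X F p n k) = elt F p n k := rfl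

lemma elt_zero : elt F p n 0 = del F p n := by
  apply Subtype.ext
  exact one_smul (DivPow F p n) (DivPow.partialD F p n)

lemma ofDivPow_one : ofDivPow F p n 1 = del F p n := elt_zero

lemma elt_of_le {k : ℕ} (hk : p ^ n ≤ k) : elt F p n k = 0 := by
  rw [← ofDivPow_X, DivPow.X_of_le F p n hk, map_zero]

lemma ofDivPow_surjective : Function.Surjective (ofDivPow F p n) := by
  rintro ⟨_, f, rfl⟩
  exact ⟨f, rfl⟩

lemma partialD_apply (f : DivPow F p n) : DivPow.partialD F p n f = DivPow.derivMap F p n f := rfl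

lemma ofDivPow_injective (hn : n ≠ 0) : Function.Injective (ofDivPow F p n) := by
  rw [injective_iff_map_eq_zero]
  intro f hf
  -- `f` is the value of `f ∂` at `x^(1)`, which is a nonzero element because `n ≠ 0`
  have h := congrArg (fun w : Zassenhaus F p n =>
    (w : Derivation F (DivPow F p n) (DivPow F p n)) (DivPow.X F p n 1)) hf
  have h1 : DivPow.partialD F p n (DivPow.X F p n 1) = 1 := by
    rw [partialD_apply, DivPow.derivMap_X F (Nat.one_lt_pow hn (Fact.out : p.Prime).one_lt),
      if_neg one_ne_zero, DivPow.one_def]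
  change f • DivPow.partialD F p n (DivPow.X F p n 1) = 0 at h
  rwa [h1, smul_eq_mul, mul_one] at h

variable (F p) in
/-- The basis of the elements `x^(k) ∂`, `0 ≤ k < p ^ n`. -/
noncomputable def eltBasis (hn : n ≠ 0) : Module.Basis (Fin (p ^ n)) F (Zassenhaus F p n) :=
  (DivPow.basis F p n).map
    (LinearEquiv.ofBijective (ofDivPow F p n) ⟨ofDivPow_injective hn, ofDivPow_surjective⟩)

lemma eltBasis_apply (hn : n ≠ 0) (k : Fin (p ^ n)) : eltBasis F p hn k = elt F p n k := by
  rw [eltBasis, Module.Basis.map_apply, DivPow.basis_eq]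
  rfl

lemma elt_ne_zero (hn : n ≠ 0) {k : ℕ} (hk : k < p ^ n) : elt F p n k ≠ 0 := by
  rw [← eltBasis_apply hn ⟨k, hk⟩]
  exact (eltBasis F p hn).ne_zero _

lemma lie_ofDivPow (f g : DivPow F p n) : ⁅ofDivPow F p n f, ofDivPow F p n g⁆ =
    ofDivPow F p n (f * DivPow.derivMap F p n g - g * DivPow.derivMap F p n f) :=
  Subtype.ext (DivPow.lie_smul_partialD F p n f g)

lemma lie_del_elt {k : ℕ} (hk : k < p ^ n) :
    ⁅del F p n, elt F p n k⁆ = if k = 0 then 0 else elt F p n (k - 1) := by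
  have h1 : DivPow.derivMap F p n 1 = 0 := by
    rw [DivPow.one_def, DivPow.derivMap_X F (pow_pos (Fact.out : p.Prime).pos n), if_pos rfl]
  rw [← ofDivPow_one, ← ofDivPow_X, lie_ofDivPow, DivPow.derivMap_X F hk, h1, one_mul, mul_zero,
    sub_zero]
  split_ifs
  · exact map_zero _
  · rfl

lemma exists_lie_elt_elt {i j : ℕ} (hi : i < p ^ n) (hj : j < p ^ n) :
    ∃ c : F, (i + j = 0 → c = 0) ∧
      ⁅elt F p n i, elt F p n j⁆ = c • elt F p n (i + j - 1) := by
  obtain ⟨c, hc0, hc⟩ := DivPow.exists_X_mul_derivMap_X (F := F) (n := n) (i := i) hj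
  obtain ⟨d, hd0, hd⟩ := DivPow.exists_X_mul_derivMap_X (F := F) (n := n) (i := j) hi
  refine ⟨c - d, fun h => by rw [hc0 h, hd0 (by omega), sub_zero], ?_⟩
  rw [← ofDivPow_X, ← ofDivPow_X, lie_ofDivPow, hc, hd, add_comm j i, ← sub_smul, map_smul,
    ofDivPow_X]

/-! ### The standard grading and its coarsenings -/

section DegreeGrading

variable {G : Type*} [AddCommGroup G]

variable (F p n) in
/-- The grading of `W(1; n)` in which `x^(k) ∂` has degree `φ (k - 1)`: the coarsening of the
standard grading along the homomorphism `φ`. -/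
noncomputable def degreeGrading (φ : ℤ →+ G) (g : G) : Submodule F (Zassenhaus F p n) :=
  Submodule.span F {w | ∃ k : ℕ, k < p ^ n ∧ φ ((k : ℤ) - 1) = g ∧ w = elt F p n k}

lemma elt_mem_degreeGrading (φ : ℤ →+ G) (k : ℕ) :
    elt F p n k ∈ degreeGrading F p n φ (φ ((k : ℤ) - 1)) := by
  rcases lt_or_ge k (p ^ n) with h | h
  · exact Submodule.subset_span ⟨k, h, rfl, rfl⟩
  · rw [elt_of_le h]
    exact zero_mem _

lemma degreeGrading_eq_span_image (hn : n ≠ 0) (φ : ℤ →+ G) (g : G) :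
    degreeGrading F p n φ g =
      Submodule.span F (eltBasis F p hn '' {k | φ (((k : ℕ) : ℤ) - 1) = g}) := by
  rw [degreeGrading]
  congr 1
  ext w
  constructor
  · rintro ⟨k, hk, hg, rfl⟩
    exact ⟨⟨k, hk⟩, hg, eltBasis_apply hn _⟩
  · rintro ⟨k, hg, rfl⟩
    exact ⟨k, k.2, hg, eltBasis_apply hn _⟩

lemma lie_mem_degreeGrading (φ : ℤ →+ G) {g h : G} {x y : Zassenhaus F p n}
    (hx : x ∈ degreeGrading F p n φ g) (hy : y ∈ degreeGrading F p n φ h) :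
    ⁅x, y⁆ ∈ degreeGrading F p n φ (g + h) := by
  induction hx using Submodule.span_induction with
  | zero => rw [zero_lie]; exact zero_mem _
  | add x x' _ _ hx hx' => rw [add_lie]; exact add_mem hx hx'
  | smul c x _ hx => rw [smul_lie]; exact Submodule.smul_mem _ _ hx
  | mem x hx =>
    induction hy using Submodule.span_induction with
    | zero => rw [lie_zero]; exact zero_mem _
    | add y y' _ _ hy hy' => rw [lie_add]; exact add_mem hy hy'
    | smul c y _ hy => rw [lie_smul]; exact Submodule.smul_mem _ _ hy
    | mem y hy =>
      obtain ⟨i, hi, rfl, rfl⟩ := hx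
      obtain ⟨j, hj, rfl, rfl⟩ := hy
      obtain ⟨c, hc0, hc⟩ := exists_lie_elt_elt (F := F) hi hj
      rw [hc]
      rcases Nat.eq_zero_or_pos (i + j) with h0 | h0
      · rw [hc0 h0, zero_smul]
        exact zero_mem _
      · have hdeg : φ ((i : ℤ) - 1) + φ ((j : ℤ) - 1) = φ (((i + j - 1 : ℕ) : ℤ) - 1) := by
          rw [← map_add]
          congr 1
          omega
        rw [hdeg]
        exact Submodule.smul_mem _ _ (elt_mem_degreeGrading φ _)

lemma isLieGrading_degreeGrading (hn : n ≠ 0) (φ : ℤ →+ G) :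
    IsLieGrading (degreeGrading F p n φ) := by
  classical
  refine ⟨?_, fun g h x hx y hy => lie_mem_degreeGrading φ hx hy⟩
  rw [DirectSum.isInternal_submodule_iff_iSupIndep_and_iSup_eq_top,
    funext (degreeGrading_eq_span_image hn φ)]
  exact ⟨iSupIndep_span_image_fiber _ _, iSup_span_image_fiber _ _⟩

lemma stdGrading_eq_degreeGrading :
    stdGrading F p n = degreeGrading F p n (AddMonoidHom.id ℤ) := by
  funext i
  rw [stdGrading, degreeGrading]
  simp only [AddMonoidHom.id_apply, sub_eq_iff_eq_add]

lemma gradingMod_stdGrading_eq_degreeGrading (m : ℕ) :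
    gradingMod m (stdGrading F p n) = degreeGrading F p n (Int.castAddHom (ZMod m)) := by
  funext i
  refine le_antisymm (iSup₂_le fun j hj => Submodule.span_mono ?_) (Submodule.span_le.mpr ?_)
  · rintro w ⟨k, hk, hkj, rfl⟩
    refine ⟨k, hk, ?_, rfl⟩
    rw [hkj, add_sub_cancel_right]
    exact hj
  · rintro w ⟨k, hk, hki, rfl⟩
    refine Submodule.mem_iSup_of_mem ((k : ℤ) - 1) (Submodule.mem_iSup_of_mem hki ?_)
    exact Submodule.subset_span ⟨k, hk, by ring, rfl⟩

end DegreeGrading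

/-! ### The derivation `D` -/

lemma ad_del_pow_elt (k : ℕ) {j : ℕ} (hj : j < p ^ n) :
    (LieAlgebra.ad F (Zassenhaus F p n) (del F p n) ^ k) (elt F p n j) =
      if k ≤ j then elt F p n (j - k) else 0 := by
  induction k with
  | zero => simp
  | succ k ih =>
    rw [pow_succ', Module.End.mul_apply, ih]
    split_ifs with h1 h2 h2
    · rw [LieAlgebra.ad_apply, lie_del_elt (by omega), if_neg (by omega)]
      congr 1
    · rw [LieAlgebra.ad_apply, lie_del_elt (by omega), if_pos (by omega)]
    · omega
    · exact map_zero _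

lemma D_pow_elt (s k : ℕ) {j : ℕ} (hj : j < p ^ n) :
    (D F p n s ^ k) (elt F p n j) = if k * p ^ s ≤ j then elt F p n (j - k * p ^ s) else 0 := by
  rw [D, ← pow_mul, mul_comm, ad_del_pow_elt _ hj]

lemma D_elt (s : ℕ) {j : ℕ} (hj : j < p ^ n) :
    D F p n s (elt F p n j) = if p ^ s ≤ j then elt F p n (j - p ^ s) else 0 :=
  ad_del_pow_elt _ hj

lemma D_lie (s : ℕ) (x y : Zassenhaus F p n) :
    D F p n s ⁅x, y⁆ = ⁅D F p n s x, y⁆ + ⁅x, D F p n s y⁆ :=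
  pow_char_pow_lie p (fun x y => by simp only [LieAlgebra.ad_apply]; rw [leibniz_lie]) s x y

lemma D_pow_eq_zero (hn : n ≠ 0) {s : ℕ} (hs : s ≤ n) : D F p n s ^ p ^ (n - s) = 0 := by
  refine (eltBasis F p hn).ext fun j => ?_
  rw [eltBasis_apply, D_pow_elt s _ j.2, LinearMap.zero_apply, if_neg]
  rw [← pow_add, Nat.sub_add_cancel hs]
  exact not_le.mpr j.2

lemma map_D_degreeGrading_le {G : Type*} [AddCommGroup G] (φ : ℤ →+ G) (s : ℕ) (g : G) :
    (degreeGrading F p n φ g).map (D F p n s) ≤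
      degreeGrading F p n φ (g - φ ((p : ℤ) ^ s)) := by
  rw [degreeGrading, Submodule.map_span, Submodule.span_le]
  rintro _ ⟨_, ⟨k, hk, rfl, rfl⟩, rfl⟩
  rw [D_elt s hk, SetLike.mem_coe]
  split_ifs with h
  · rw [← map_sub]
    convert! elt_mem_degreeGrading φ (k - p ^ s) using 2
    congr 1
    push_cast [h]
    ring
  · exact zero_mem _

lemma switchedGrading_eq_map (s : ℕ) :
    switchedGrading F p n s = fun g => (degreeGrading F p n (Int.castAddHom (ZMod (p ^ (s + 1)))) g
      ).map (artinHasseEnd p (D F p n s)) := by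
  funext g
  rw [switchedGrading, gradingMod_stdGrading_eq_degreeGrading]

theorem isLieGrading_switchedGrading {s : ℕ} (hs : s < n) :
    IsLieGrading (switchedGrading F p n s) := by
  rw [switchedGrading_eq_map]
  refine (isLieGrading_degreeGrading (by omega) _).map_artinHasseEnd p (D_lie s)
    (d := Int.castAddHom (ZMod (p ^ (s + 1))) ((p : ℤ) ^ s)) ?_
    (fun g => map_D_degreeGrading_le _ s g) ⟨_, D_pow_eq_zero (by omega) hs.le⟩
  rw [← map_nsmul, nsmul_eq_mul, ← pow_succ', Int.coe_castAddHom]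
  have := ZMod.natCast_self (p ^ (s + 1))
  push_cast at this ⊢
  exact this

end Zassenhaus

/-! ### The components of the switched grading -/

/-- Below degree `p` the coefficients of `E_p` satisfy the recursion of those of `exp`. -/
lemma natCast_mul_coeff_artinHasseMod_of_lt (F : Type*) [Field F] {p : ℕ} [Fact p.Prime]
    [CharP F p] {k : ℕ} (hk : k + 1 < p) :
    ((k : F) + 1) * PowerSeries.coeff (k + 1) (artinHasseMod F p) =
      PowerSeries.coeff k (artinHasseMod F p) := by
  have h := natCast_mul_coeff_artinHasseMod (p := p) F (k + 1)
  rw [PowerSeries.coeff_mul, Finset.sum_eq_single (1, k)] at h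
  · rw [primePowSeries, PowerSeries.coeff_mk, if_pos ⟨0, (pow_zero p).symm⟩, one_mul] at h
    push_cast at h
    exact h
  · rintro ⟨i, j⟩ hij hne
    rw [Finset.HasAntidiagonal.mem_antidiagonal] at hij
    rw [primePowSeries, PowerSeries.coeff_mk, if_neg, zero_mul]
    rintro ⟨m, hm⟩
    rcases m with _ | m
    · simp only [pow_zero] at hm hij
      exact hne (Prod.ext hm (by simp only; omega))
    · have : p ≤ p ^ (m + 1) := Nat.le_self_pow m.succ_ne_zero p
      simp only at hm hij
      omega
  · intro h
    exact absurd (Finset.HasAntidiagonal.mem_antidiagonal.mpr (by simp only; omega)) h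

lemma coeff_artinHasseMod_ne_zero (F : Type*) [Field F] {p : ℕ} [Fact p.Prime]
    [CharP F p] {k : ℕ} (hk : k < p) : PowerSeries.coeff k (artinHasseMod F p) ≠ 0 := by
  induction k with
  | zero =>
    rw [PowerSeries.coeff_zero_eq_constantCoeff_apply, constantCoeff_artinHasseMod]
    exact one_ne_zero
  | succ k ih =>
    intro h0
    refine ih (by omega) ?_
    rw [← natCast_mul_coeff_artinHasseMod_of_lt F hk, h0, mul_zero]

namespace Zassenhaus

variable {F : Type*} [Field F] {p n : ℕ} [Fact p.Prime] [CharP F p]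

variable (F p n) in
/-- The element `E_p(D) x^(k) ∂`. -/
noncomputable def switchedElt (s k : ℕ) : Zassenhaus F p n :=
  artinHasseEnd p (D F p n s) (elt F p n k)

lemma switchedElt_mem (s k : ℕ) :
    switchedElt F p n s k ∈ switchedGrading F p n s ((k : ZMod (p ^ (s + 1))) - 1) := by
  rw [switchedGrading_eq_map]
  refine Submodule.mem_map_of_mem ?_
  convert! elt_mem_degreeGrading _ k using 2
  simp

lemma artinHasseEnd_D_injective {s : ℕ} (hs : s < n) :
    Function.Injective (artinHasseEnd p (D F p n s)) :=
  (artinHasseEquiv p ⟨_, D_pow_eq_zero (F := F) (p := p) (by omega : n ≠ 0) hs.le⟩).injective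

lemma switchedElt_ne_zero {s : ℕ} (hs : s < n) {k : ℕ} (hk : k < p ^ n) :
    switchedElt F p n s k ≠ 0 := by
  rw [switchedElt, Ne, map_eq_zero_iff _ (artinHasseEnd_D_injective hs)]
  exact elt_ne_zero (by omega) hk

lemma switchedElt_eq_sum {s : ℕ} (hs : s < n) (k : ℕ) :
    switchedElt F p n s k = ∑ i ∈ Finset.range (p ^ (n - s)),
      PowerSeries.coeff i (artinHasseMod F p) • (D F p n s ^ i) (elt F p n k) := by
  rw [switchedElt, artinHasseEnd_eq_aeval p (D_pow_eq_zero (by omega : n ≠ 0) hs.le),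
    PowerSeries.aeval_trunc_eq_sum, LinearMap.sum_apply]
  rfl

/-- `E_p(D)` commutes with `ad ∂`, because `D` is a power of `ad ∂`. -/
lemma lie_del_switchedElt (s : ℕ) {k : ℕ} (hk : k < p ^ n) :
    ⁅del F p n, switchedElt F p n s k⁆ = if k = 0 then 0 else switchedElt F p n s (k - 1) := by
  have hcomm : Commute (LieAlgebra.ad F (Zassenhaus F p n) (del F p n))
      (artinHasseEnd p (D F p n s)) := by
    rw [artinHasseEnd]
    exact Commute.sum_right _ _ _ fun i _ =>
      (((Commute.refl _).pow_right _).pow_right _).smul_right _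
  have h := LinearMap.congr_fun hcomm.eq (elt F p n k)
  rw [Module.End.mul_apply, Module.End.mul_apply, LieAlgebra.ad_apply, LieAlgebra.ad_apply,
    lie_del_elt hk] at h
  rw [switchedElt, h]
  split_ifs
  · exact map_zero _
  · rfl

lemma switchedElt_zero {s : ℕ} (hs : s < n) : switchedElt F p n s 0 = del F p n := by
  have hpp : p.Prime := Fact.out
  rw [switchedElt_eq_sum hs, Finset.sum_eq_single 0]
  · rw [pow_zero, Module.End.one_apply, PowerSeries.coeff_zero_eq_constantCoeff_apply,
      constantCoeff_artinHasseMod, one_smul, elt_zero]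
  · intro i _ hi
    rw [D_pow_elt s i (pow_pos hpp.pos n), if_neg, smul_zero]
    have := Nat.mul_pos (Nat.pos_of_ne_zero hi) (pow_pos hpp.pos s)
    omega
  · intro h
    exact absurd (Finset.mem_range.mpr (pow_pos hpp.pos _)) h

lemma del_mem_switchedGrading {s : ℕ} (hs : s < n) :
    del F p n ∈ switchedGrading F p n s (-1) := by
  have h := switchedElt_mem (F := F) (p := p) (n := n) s 0
  rwa [switchedElt_zero hs, Nat.cast_zero, zero_sub] at h

lemma exists_eq_natCast_sub_one {m : ℕ} [NeZero m] (g : ZMod m) :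
    ∃ k < m, g = (k : ZMod m) - 1 :=
  ⟨(g + 1).val, ZMod.val_lt _, by rw [ZMod.natCast_zmod_val, add_sub_cancel_right]⟩

lemma pow_succ_le_pow {s : ℕ} (hs : s < n) : p ^ (s + 1) ≤ p ^ n :=
  Nat.pow_le_pow_right (Fact.out : p.Prime).pos hs

lemma closure_gradingSupport_switchedGrading {s : ℕ} (hs : s < n) :
    AddSubgroup.closure (gradingSupport (switchedGrading F p n s)) = ⊤ := by
  have : NeZero (p ^ (s + 1)) := ⟨pow_ne_zero _ (Fact.out : p.Prime).ne_zero⟩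
  have hsup : gradingSupport (switchedGrading F p n s) = Set.univ := by
    refine Set.eq_univ_of_forall fun g => ?_
    obtain ⟨k, hk, rfl⟩ := exists_eq_natCast_sub_one g
    intro h0
    have h := switchedElt_mem (F := F) (p := p) (n := n) s k
    rw [h0, Submodule.mem_bot] at h
    exact switchedElt_ne_zero hs (hk.trans_le (pow_succ_le_pow hs)) h
  rw [hsup, AddSubgroup.closure_univ]

/-! ### The bracket of two elements whose degrees add up to `p ^ (s + 1) - 1` -/

/-- The coefficient of `x^(r) ∂`. -/
noncomputable def eltCoeff (hn : n ≠ 0) {r : ℕ} (hr : r < p ^ n) : Zassenhaus F p n →ₗ[F] F :=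
  (eltBasis F p hn).coord ⟨r, hr⟩

lemma eltCoeff_elt (hn : n ≠ 0) {r : ℕ} (hr : r < p ^ n) {k : ℕ} (hk : k < p ^ n) :
    eltCoeff hn hr (elt F p n k) = if k = r then 1 else 0 := by
  rw [eltCoeff, ← eltBasis_apply hn ⟨k, hk⟩, Module.Basis.coord_apply, Module.Basis.repr_self,
    Finsupp.single_apply]
  simp [Fin.ext_iff]

lemma lie_elt_one_del (h1 : 1 < p ^ n) : ⁅elt F p n 1, del F p n⁆ = - del F p n := by
  rw [← lie_skew, lie_del_elt h1, if_neg one_ne_zero, elt_zero]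

/-- The coefficient of `∂` in a bracket `[f ∂, g ∂]` is `f(0) g'(0) - g(0) f'(0)`. -/
lemma eltCoeff_zero_lie (hn : n ≠ 0) (h0 : 0 < p ^ n) (h1 : 1 < p ^ n)
    (y z : Zassenhaus F p n) :
    eltCoeff hn h0 ⁅y, z⁆ =
      eltCoeff hn h0 y * eltCoeff hn h1 z - eltCoeff hn h1 y * eltCoeff hn h0 z := by
  let b : Zassenhaus F p n →ₗ[F] Zassenhaus F p n →ₗ[F] F :=
    (LieAlgebra.ad F (Zassenhaus F p n) : _ →ₗ[F] _).compr₂ (eltCoeff hn h0)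
  let c : Zassenhaus F p n →ₗ[F] Zassenhaus F p n →ₗ[F] F :=
    (LinearMap.mul F F).compl₁₂ (eltCoeff hn h0) (eltCoeff hn h1) -
      (LinearMap.mul F F).compl₁₂ (eltCoeff hn h1) (eltCoeff hn h0)
  have hbc : b = c := by
    refine (eltBasis F p hn).ext fun i => (eltBasis F p hn).ext fun j => ?_
    rw [eltBasis_apply, eltBasis_apply]
    change eltCoeff hn h0 ⁅elt F p n i, elt F p n j⁆ =
      eltCoeff hn h0 (elt F p n i) * eltCoeff hn h1 (elt F p n j) -
        eltCoeff hn h1 (elt F p n i) * eltCoeff hn h0 (elt F p n j)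
    rw [eltCoeff_elt hn h0 i.2, eltCoeff_elt hn h1 i.2, eltCoeff_elt hn h0 j.2,
      eltCoeff_elt hn h1 j.2]
    obtain ⟨i, hi⟩ := i
    obtain ⟨j, hj⟩ := j
    simp only
    obtain ⟨d, hd0, hd⟩ := exists_lie_elt_elt (F := F) hi hj
    rcases Nat.lt_or_ge (i + j) 2 with h | h
    · obtain ⟨rfl, rfl⟩ | ⟨rfl, rfl⟩ | ⟨rfl, rfl⟩ :
          (i = 0 ∧ j = 0) ∨ (i = 0 ∧ j = 1) ∨ (i = 1 ∧ j = 0) := by omega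
      · rw [lie_self]
        simp
      · rw [elt_zero, lie_del_elt h1, if_neg one_ne_zero, eltCoeff_elt hn h0 h0]
        simp
      · rw [elt_zero, lie_elt_one_del h1, ← elt_zero, map_neg, eltCoeff_elt hn h0 h0]
        simp
    · have hl : eltCoeff hn h0 (elt F p n (i + j - 1)) = 0 := by
        rcases lt_or_ge (i + j - 1) (p ^ n) with hlt | hge
        · rw [eltCoeff_elt hn h0 hlt, if_neg (by omega)]
        · rw [elt_of_le hge, map_zero]
      rw [hd, map_smul, hl, smul_zero]
      split_ifs <;> first | omega | simp
  exact LinearMap.congr_fun₂ hbc y z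

/-- The coefficients of the elements `E_p(D) x^(k) ∂` for `n = s + 1`. -/
lemma eltCoeff_switchedElt {s r k : ℕ} (hr : r < p ^ (s + 1)) (hk : k < p ^ (s + 1)) :
    eltCoeff s.succ_ne_zero hr (switchedElt F p (s + 1) s k) = ∑ i ∈ Finset.range p,
      if k = i * p ^ s + r then PowerSeries.coeff i (artinHasseMod F p) else 0 := by
  rw [switchedElt_eq_sum s.lt_succ_self, map_sum, show p ^ (s.succ - s) = p by simp]
  refine Finset.sum_congr rfl fun i _ => ?_
  rw [map_smul, D_pow_elt s i hk]
  by_cases h : i * p ^ s ≤ k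
  · rw [if_pos h, eltCoeff_elt _ hr (by omega), smul_eq_mul, mul_ite, mul_one, mul_zero]
    exact if_congr (by omega) rfl rfl
  · rw [if_neg h, if_neg (by omega), map_zero, smul_zero]

/-- For `n = s + 1`, two components with degrees adding up to `p ^ (s + 1) - 1` do not commute.
With `e_k` the coefficients of `E_p` modulo `p`, the coefficient of `∂` in the bracket is
`e_2 e_(p-2)` if `s > 0`, and `e_2 e_(p-2) - e_1 e_(p-1) = -3 e_2 e_(p-1)` if `s = 0`. -/
lemma lie_switchedElt_ne_zero (hp : 3 < p) (s : ℕ) :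
    ⁅switchedElt F p (s + 1) s (2 * p ^ s), switchedElt F p (s + 1) s ((p - 2) * p ^ s + 1)⁆ ≠
      0 := by
  have hps : 0 < p ^ s := pow_pos (by omega) s
  obtain ⟨q, rfl⟩ : ∃ q, p = q + 4 := ⟨p - 4, by omega⟩
  have hpow : (q + 4) ^ (s + 1) = (q + 4) * (q + 4) ^ s := pow_succ' _ _
  have h1 : 1 < (q + 4) ^ (s + 1) := Nat.one_lt_pow s.succ_ne_zero (by omega)
  have h0 : 0 < (q + 4) ^ (s + 1) := by omega
  rw [show q + 4 - 2 = q + 2 by omega]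
  have hu : 2 * (q + 4) ^ s < (q + 4) ^ (s + 1) := by
    rw [hpow]
    exact Nat.mul_lt_mul_of_pos_right (by omega) hps
  have hv : (q + 2) * (q + 4) ^ s + 1 < (q + 4) ^ (s + 1) := by
    rw [hpow]
    nlinarith
  intro hzero
  have h := eltCoeff_zero_lie s.succ_ne_zero h0 h1
    (switchedElt F (q + 4) (s + 1) s (2 * (q + 4) ^ s))
    (switchedElt F (q + 4) (s + 1) s ((q + 2) * (q + 4) ^ s + 1))
  rw [hzero, map_zero, eltCoeff_switchedElt h0 hu, eltCoeff_switchedElt h1 hu,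
    eltCoeff_switchedElt h0 hv, eltCoeff_switchedElt h1 hv] at h
  have hinj : ∀ i j : ℕ, i * (q + 4) ^ s = j * (q + 4) ^ s ↔ i = j := fun i j =>
    ⟨fun h => Nat.eq_of_mul_eq_mul_right hps h, fun h => by rw [h]⟩
  simp only [add_zero, add_left_inj, hinj] at h
  rw [Finset.sum_ite_eq, Finset.sum_ite_eq, if_pos (Finset.mem_range.mpr (by omega)),
    if_pos (Finset.mem_range.mpr (by omega))] at h
  have e2 := coeff_artinHasseMod_ne_zero F (p := q + 4) (k := 2) (by omega)
  have eq2 := coeff_artinHasseMod_ne_zero F (p := q + 4) (k := q + 2) (by omega)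
  rcases s with _ | s
  · -- here the coefficients of `x ∂` and of `∂` contribute as well
    simp only [pow_zero, mul_one, Nat.reduceEqDiff] at h
    rw [Finset.sum_eq_single 1 (fun i _ hi => if_neg (by omega)) (fun h => absurd
      (Finset.mem_range.mpr (by omega)) h), if_pos rfl,
      Finset.sum_eq_single (q + 3) (fun i _ hi => if_neg (by omega)) (fun h => absurd
      (Finset.mem_range.mpr (by omega)) h), if_pos rfl] at h
    have r1 := natCast_mul_coeff_artinHasseMod_of_lt F (p := q + 4) (k := 1) (by omega)
    have r2 := natCast_mul_coeff_artinHasseMod_of_lt F (p := q + 4) (k := q + 2) (by omega)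
    have hq : (q : F) + 4 = 0 := by
      have := CharP.cast_eq_zero F (q + 4)
      push_cast at this
      exact this
    have h3 : (3 : F) ≠ 0 := by
      intro h3
      have := (CharP.cast_eq_zero_iff F (q + 4) 3).mp (by exact_mod_cast h3)
      exact absurd (Nat.le_of_dvd (by omega) this) (by omega)
    have e3 := coeff_artinHasseMod_ne_zero F (p := q + 4) (k := q + 3) (by omega)
    push_cast at r1 r2
    norm_num at r1 r2
    rw [← r1, ← r2] at h
    refine mul_ne_zero (mul_ne_zero h3 e2) e3 ?_
    linear_combination h + PowerSeries.coeff 2 (artinHasseMod F (q + 4)) *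
      PowerSeries.coeff (q + 3) (artinHasseMod F (q + 4)) * hq
  · have hnd : ∀ i j : ℕ, i * (q + 4) ^ (s + 1) ≠ j * (q + 4) ^ (s + 1) + 1 := by
      intro i j hij
      have hd : (q + 4) ^ (s + 1) ∣ 1 :=
        (Nat.dvd_add_right (Dvd.intro_left j rfl)).mp (hij ▸ Dvd.intro_left i rfl)
      have hlt : 1 < (q + 4) ^ (s + 1) := Nat.one_lt_pow s.succ_ne_zero (by omega)
      exact absurd (Nat.le_of_dvd one_pos hd) (by omega)
    rw [Finset.sum_eq_zero (s := Finset.range (q + 4)) (fun i _ => if_neg (hnd 2 i)), zero_mul,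
      sub_zero] at h
    exact mul_ne_zero e2 eq2 h.symm

end Zassenhaus

/-! ### The universal group -/

namespace Zassenhaus

variable {F : Type*} [Field F] {p n : ℕ} [Fact p.Prime] [CharP F p]

section Universal

variable {H : Type*} [AddCommGroup H] {Γ' : H → Submodule F (Zassenhaus F p n)} {s : ℕ}
  {α : ZMod (p ^ (s + 1)) → H}

/-- Degrees in a coarsening are additive on noncommuting homogeneous elements. -/
lemma degree_add_of_lie_ne_zero (hs : s < n) (hΓ' : IsLieGrading Γ')
    (hα : ∀ g, switchedGrading F p n s g ≤ Γ' (α g)) {g h : ZMod (p ^ (s + 1))}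
    {y z : Zassenhaus F p n} (hy : y ∈ switchedGrading F p n s g)
    (hz : z ∈ switchedGrading F p n s h) (hyz : ⁅y, z⁆ ≠ 0) : α (g + h) = α g + α h :=
  hΓ'.eq_of_mem (hα _ ((isLieGrading_switchedGrading hs).lie_mem _ _ _ hy _ hz))
    (hΓ'.lie_mem _ _ _ (hα _ hy) _ (hα _ hz)) hyz

/-- Bracketing with `∂` lowers the degree in a coarsening by a constant. -/
lemma degree_sub_one (hs : s < n) (hΓ' : IsLieGrading Γ')
    (hα : ∀ g, switchedGrading F p n s g ≤ Γ' (α g)) {k : ℕ} (hk0 : k ≠ 0) (hk : k < p ^ n) :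
    α ((k : ZMod (p ^ (s + 1))) - 1 - 1) = α ((k : ZMod (p ^ (s + 1))) - 1) + α (-1) := by
  have hne : ⁅del F p n, switchedElt F p n s k⁆ ≠ 0 := by
    rw [lie_del_switchedElt s hk, if_neg hk0]
    exact switchedElt_ne_zero hs (by omega)
  have h := degree_add_of_lie_ne_zero hs hΓ' hα (del_mem_switchedGrading hs)
    (switchedElt_mem s k) hne
  rwa [neg_add_eq_sub, add_comm (α (-1))] at h

/-- Since `∂` has degree `-1`, the degree map to a coarsening is linear on the representatives
`-1, …, p ^ n - 2`. -/
lemma degree_eq_zsmul (hs : s < n) (hΓ' : IsLieGrading Γ')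
    (hα : ∀ g, switchedGrading F p n s g ≤ Γ' (α g)) {k : ℕ} (hk : k < p ^ n) :
    α ((k : ZMod (p ^ (s + 1))) - 1) = ((k : ℤ) - 1) • -α (-1) := by
  induction k with
  | zero => simp
  | succ k ih =>
    have h := degree_sub_one hs hΓ' hα k.succ_ne_zero hk
    rw [Nat.cast_succ, add_sub_cancel_right, ih (by omega)] at h
    rw [Nat.cast_succ, add_sub_cancel_right, ← sub_eq_iff_eq_add.mpr h, Nat.cast_succ,
      add_sub_cancel_right, sub_smul, one_smul]
    abel

/-- The degree of `∂` in a coarsening has order dividing `p ^ (s + 1)`. -/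
lemma pow_smul_degree_del (hp : 3 < p) (hs : s < n) (hΓ' : IsLieGrading Γ')
    (hα : ∀ g, switchedGrading F p n s g ≤ Γ' (α g)) :
    ((p ^ (s + 1) : ℕ) : ℤ) • -α (-1) = 0 := by
  have hps : 0 < p ^ s := pow_pos (by omega) s
  have hpow : p ^ (s + 1) = p * p ^ s := pow_succ' _ _
  rcases (Nat.succ_le_of_lt hs).lt_or_eq with hlt | rfl
  · -- the degree of `x^(p ^ (s + 1)) ∂` modulo `p ^ (s + 1)` is that of `∂`
    have hk : p ^ (s + 1) < p ^ n := Nat.pow_lt_pow_right (by omega) hlt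
    have h := degree_eq_zsmul hs hΓ' hα hk
    rw [ZMod.natCast_self, zero_sub, sub_smul, one_smul, sub_neg_eq_add, right_eq_add] at h
    exact h
  · have hu : 2 * p ^ s < p ^ (s + 1) := by
      rw [hpow]
      exact Nat.mul_lt_mul_of_pos_right (by omega) hps
    have hv : (p - 2) * p ^ s + 1 < p ^ (s + 1) := by
      have h2 : (p - 2) * p ^ s + 2 * p ^ s = p * p ^ s := by
        rw [← add_mul, Nat.sub_add_cancel (by omega)]
      omega
    have h := degree_add_of_lie_ne_zero hs hΓ' hα (switchedElt_mem s (2 * p ^ s))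
      (switchedElt_mem s ((p - 2) * p ^ s + 1)) (lie_switchedElt_ne_zero hp s)
    have hsum : 2 * p ^ s + (p - 2) * p ^ s = p ^ (s + 1) := by
      rw [hpow, ← add_mul, Nat.add_sub_cancel' (by omega)]
    have hdeg : ((2 * p ^ s : ℕ) : ZMod (p ^ (s + 1))) - 1 +
        (((p - 2) * p ^ s + 1 : ℕ) - 1) = -1 := by
      have := congrArg (Nat.cast : ℕ → ZMod (p ^ (s + 1))) hsum
      rw [ZMod.natCast_self, Nat.cast_add] at this
      rw [Nat.cast_succ, add_sub_cancel_right, sub_add_eq_add_sub, this, zero_sub]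
    rw [hdeg, degree_eq_zsmul hs hΓ' hα hu, degree_eq_zsmul hs hΓ' hα hv, ← add_smul] at h
    have hz : ((2 * p ^ s : ℕ) : ℤ) - 1 + (((p - 2) * p ^ s + 1 : ℕ) - 1) =
        ((p ^ (s + 1) : ℕ) : ℤ) - 1 := by
      rw [← hsum]
      push_cast
      ring
    rw [hz, sub_smul, one_smul, sub_neg_eq_add, right_eq_add] at h
    exact h

end Universal

theorem isUniversalGroup_switchedGrading {F : Type u} [Field F] {p n : ℕ} [Fact p.Prime]
    [CharP F p] (hp : 3 < p) {s : ℕ} (hs : s < n) :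
    IsUniversalGroup.{u, u, w, 0} (switchedGrading F p n s) := by
  have : NeZero (p ^ (s + 1)) := ⟨pow_ne_zero _ (Fact.out : p.Prime).ne_zero⟩
  intro H _ Γ' hΓ' href
  choose α hα using href
  let f : ZMod (p ^ (s + 1)) →+ H := ZMod.lift (p ^ (s + 1))
    ⟨zmultiplesHom H (-α (-1)), pow_smul_degree_del hp hs hΓ' hα⟩
  have hf : ∀ g, f g = α g := by
    intro g
    obtain ⟨k, hk, rfl⟩ := exists_eq_natCast_sub_one g
    rw [degree_eq_zsmul hs hΓ' hα (hk.trans_le (pow_succ_le_pow hs))]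
    have hcast : (k : ZMod (p ^ (s + 1))) - 1 = (((k : ℤ) - 1 : ℤ) : ZMod (p ^ (s + 1))) := by
      push_cast
      rfl
    rw [hcast, ZMod.lift_coe]
    rfl
  refine ⟨f, fun g => by rw [hf]; exact hα g, fun f' hf' => ?_⟩
  ext g
  obtain ⟨k, hk, rfl⟩ := exists_eq_natCast_sub_one g
  rw [hf]
  exact hΓ'.eq_of_mem (hf' _ (switchedElt_mem s k)) (hα _ (switchedElt_mem s k))
    (switchedElt_ne_zero hs (hk.trans_le (pow_succ_le_pow hs)))

/-! ### The case `n = s + 1` -/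

/-- For `n = s + 1` the components are one-dimensional. -/
lemma switchedGrading_le_span (s k : ℕ) (hk : k < p ^ (s + 1)) :
    switchedGrading F p (s + 1) s ((k : ZMod (p ^ (s + 1))) - 1) ≤
      Submodule.span F {switchedElt F p (s + 1) s k} := by
  rw [switchedGrading_eq_map]
  beta_reduce
  rw [degreeGrading, Submodule.map_span, Submodule.span_le]
  rintro _ ⟨_, ⟨j, hj, hjk, rfl⟩, rfl⟩
  have hjk' : (j : ZMod (p ^ (s + 1))) = k := by
    simpa using hjk
  rw [ZMod.natCast_eq_natCast_iff', Nat.mod_eq_of_lt hj, Nat.mod_eq_of_lt hk] at hjk'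
  rw [hjk']
  exact Submodule.mem_span_singleton_self _

theorem isFineGrading_switchedGrading {F : Type u} [Field F] {p : ℕ} [Fact p.Prime]
    [CharP F p] (s : ℕ) : IsFineGrading.{u, u, w, 0} (switchedGrading F p (s + 1) s) := by
  have : NeZero (p ^ (s + 1)) := ⟨pow_ne_zero _ (Fact.out : p.Prime).ne_zero⟩
  rintro H _ Γ' - ⟨-, h, hh, g, hlt⟩
  obtain ⟨k, hk, rfl⟩ := exists_eq_natCast_sub_one g
  obtain ⟨y, hy, hy0⟩ := Submodule.exists_mem_ne_zero_of_ne_bot hh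
  obtain ⟨c, rfl⟩ := Submodule.mem_span_singleton.mp (switchedGrading_le_span s k hk (hlt.le hy))
  have hc : c ≠ 0 := by
    rintro rfl
    exact hy0 (zero_smul _ _)
  refine hlt.not_ge ((switchedGrading_le_span s k hk).trans ?_)
  rw [Submodule.span_singleton_le_iff_mem]
  exact (Submodule.smul_mem_iff _ hc).mp hy

/-- The universal group of the switched grading is finite, and every homomorphism from a finite
group to `ℤ` is trivial, so the switched grading has no `ℤ`-coarsening with several nonzero
components. -/
theorem not_areEquivalentGradings_switchedGrading (hp : 3 < p) {s : ℕ} (hs : s < n) :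
    ¬ AreEquivalentGradings (switchedGrading F p n s) (stdGrading F p n) := by
  rintro ⟨φ, α, hφ⟩
  have hstd : IsLieGrading (stdGrading F p n) := by
    rw [stdGrading_eq_degreeGrading]
    exact isLieGrading_degreeGrading (by omega) _
  -- the standard grading, transported by the inverse of the automorphism
  have hΓ' := hstd.map_lieEquiv φ.symm
  have href : IsRefinement (switchedGrading F p n s)
      (fun i => (stdGrading F p n i).map (φ.symm : Zassenhaus F p n →ₗ[F] Zassenhaus F p n)) := by
    intro g
    by_cases hg : g ∈ gradingSupport (switchedGrading F p n s)
    · refine ⟨α ⟨g, hg⟩, fun x hx => ?_⟩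
      beta_reduce
      rw [← hφ ⟨g, hg⟩]
      exact ⟨φ x, Submodule.mem_map_of_mem hx, φ.symm_apply_apply x⟩
    · refine ⟨0, ?_⟩
      rw [not_not.mp hg]
      exact bot_le
  obtain ⟨f, hf, -⟩ := isUniversalGroup_switchedGrading hp hs ℤ _ hΓ' href
  have hf0 : ∀ g, f g = 0 := by
    intro g
    have h : (p ^ (s + 1)) • f g = 0 := by
      rw [← map_nsmul, nsmul_eq_mul, ZMod.natCast_self, zero_mul, map_zero]
    exact (smul_eq_zero.mp h).resolve_left (pow_ne_zero _ (by omega))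
  have htop : (stdGrading F p n 0).map
      (φ.symm : Zassenhaus F p n →ₗ[F] Zassenhaus F p n) = ⊤ := by
    rw [eq_top_iff, ← (isLieGrading_switchedGrading (F := F) (p := p) hs).iSup_eq_top]
    refine iSup_le fun g => ?_
    have h := hf g
    rwa [hf0] at h
  obtain ⟨x, hx, hxe⟩ : φ.symm (del F p n) ∈ (stdGrading F p n 0).map
      (φ.symm : Zassenhaus F p n →ₗ[F] Zassenhaus F p n) := htop ▸ Submodule.mem_top
  have hx' : x = del F p n := φ.symm.injective hxe
  have hpos : 0 < p ^ n := pow_pos (by omega) n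
  have hdel : del F p n ∈ stdGrading F p n (-1) :=
    Submodule.subset_span ⟨0, hpos, by norm_num, elt_zero.symm⟩
  have hne : del F p n ≠ 0 := by
    rw [← elt_zero]
    exact elt_ne_zero (by omega) hpos
  exact absurd (hstd.eq_of_mem (hx' ▸ hx) hdel hne) (by norm_num)

end Zassenhaus

theorem mainTheorem3 (F : Type u) [Field F] (p : ℕ) [Fact p.Prime] [CharP F p] (hp : 3 < p)
    (n s : ℕ) (hs : s < n) :
    -- the standard grading, and `D`: a derivation, graded of degree `-p ^ s`, nilpotent
    (IsLieGrading (Zassenhaus.stdGrading F p n) ∧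
      (∀ x y : Zassenhaus F p n, Zassenhaus.D F p n s ⁅x, y⁆ =
        ⁅Zassenhaus.D F p n s x, y⁆ + ⁅x, Zassenhaus.D F p n s y⁆) ∧
      (∀ i : ℤ, (Zassenhaus.stdGrading F p n i).map (Zassenhaus.D F p n s) ≤
        Zassenhaus.stdGrading F p n (i - (p : ℤ) ^ s)) ∧
      Zassenhaus.D F p n s ^ p ^ (n - s) = 0) ∧
    -- the switched grading, and its universal group
    (IsLieGrading (Zassenhaus.switchedGrading F p n s) ∧
      AddSubgroup.closure (gradingSupport (Zassenhaus.switchedGrading F p n s)) = ⊤ ∧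
      IsUniversalGroup.{u, u, w, 0} (Zassenhaus.switchedGrading F p n s)) ∧
    -- the case `n = s + 1`
    (n = s + 1 →
      IsFineGrading.{u, u, w, 0} (Zassenhaus.switchedGrading F p n s) ∧
      ¬ AreEquivalentGradings (Zassenhaus.switchedGrading F p n s)
        (Zassenhaus.stdGrading F p n)) := by
  have hn : n ≠ 0 := by omega
  refine ⟨⟨?_, Zassenhaus.D_lie s, ?_, Zassenhaus.D_pow_eq_zero hn hs.le⟩,
    ⟨Zassenhaus.isLieGrading_switchedGrading hs,
      Zassenhaus.closure_gradingSupport_switchedGrading hs,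
      Zassenhaus.isUniversalGroup_switchedGrading hp hs⟩, ?_⟩
  · rw [Zassenhaus.stdGrading_eq_degreeGrading]
    exact Zassenhaus.isLieGrading_degreeGrading hn _
  · rw [Zassenhaus.stdGrading_eq_degreeGrading]
    exact Zassenhaus.map_D_degreeGrading_le (AddMonoidHom.id ℤ) s
  · rintro rfl
    exact ⟨Zassenhaus.isFineGrading_switchedGrading s,
      Zassenhaus.not_areEquivalentGradings_switchedGrading hp hs⟩
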